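/- **Model.** Let $\Delta\ge 2$. A network is an $n$-node $\Delta$-regular simple graph $G=(V,E)$ in which every node numbers its incident edges by ports $1,\dots,\Delta$ (arbitrarily, by an adversary). We use the randomized LOCAL model with shared randomness and without identifiers: every node has a private infinite stream of independent fair bits, there is one infinite stream of fair bits shared by all nodes, and every node first renumbers its ports by a private, independent, uniformly random permutation. In each synchronous round, a node sends an arbitrary message through each of its ports (and may include the port number), receives the messages of its neighbours, and performs an arbitrary (measurable) local computation; all nodes run the same algorithm, which may depend on $n$ and $\Delta$. A *$T$-round algorithm* outputs, after $T$ rounds, a label $\mathsf M$ or $\mathsf U$ on every port of every node. The *radius-$k$ view* of a node is everything that it can learn in $k$ rounds (shared bits, and the private bits and port numbers in its radius-$k$ neighbourhood). **Grabbing.** An algorithm is a *no-error* algorithm for $b$-grabbing on $G$ if, for every outcome of the random choices, every node labels exactly $b$ of its ports $\mathsf M$. An edge is *matched* if both of its half-edges are labelled $\mathsf M$, each by its own endpoint. If $q$ edges are matched, the *badness* of the solution is $1-\frac{2q}{bn}$. **Statement.** There is a universal constant $c>1$ such that the following holds. Let $\varepsilon>0$, let $n$, $\Delta\ge 2$, $b\ge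 1$, $T\ge 1$ be integers with $T\le\frac{\varepsilon}{4}\log_\Delta n$, and let $\mathcal A$ be a $T$-round algorithm. Then there is a $(T-1)$-round algorithm $\mathcal A'$ such that, for every $n$-node $\Delta$-regular graph $G$ of girth at least $\varepsilon\log_\Delta n$, every port numbering of $G$ and every real $p$: if $\mathcal A$ is a no-error algorithm for $b$-grabbing on $G$ with expected badness at most $p$, then $\mathcal A'$ is a no-error algorithm for $b$-grabbing on $G$ with expected badness at most $c\cdot\sqrt b\cdot p$. Moreover, $\mathcal A'$ grabs the preferred directions: for every node $v$, almost surely, the ports that $v$ labels $\mathsf M$ under $\mathcal A'$ are exactly the $b$ ports $i$ with the largest values of $x_i(v)$, ties being broken in favour of the smallest port numbers, where $x_i(v)$ is the conditional probability, given the radius-$(T-1)$ view of $v$, that $\mathcal A$ outputs $\mathsf M$ on port $i$ of $v$. -/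

import Mathlib

open MeasureTheory ProbabilityTheory
open scoped ENNReal

noncomputable section

namespace Grabbing

/-! ### Networks and their randomness -/

/-- An infinite stream of bits. -/
abbrev BitStream : Type := ℕ → Bool

/-- The law of an infinite stream of independent fair coin flips. -/
def coinMeasure : Measure BitStream :=
  Measure.infinitePi fun _ : ℕ => uniformOn (Set.univ : Set Bool)

/-- There are finitely many permutations of the ports; every set of them is an event. -/
instance permMeasurableSpace (Δ : ℕ) : MeasurableSpace (Equiv.Perm (Fin Δ)) := ⊤

/-- A port numbering (given by an adversary) of a `Δ`-regular graph: at every node `v`, the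
ports `Fin Δ` are in bijection with the neighbours of `v`. -/
abbrev PortNumbering {V : Type} (G : SimpleGraph V) (Δ : ℕ) : Type :=
  ∀ v : V, Fin Δ ≃ G.neighborSet v

/-- The outcome of all random choices: a shared stream of bits and, privately for every node,
a permutation with which the node renumbers its ports and a stream of bits. -/
abbrev Outcome (V : Type) (Δ : ℕ) : Type :=
  BitStream × (V → Equiv.Perm (Fin Δ) × BitStream)

/-- All random choices are independent; permutations are uniform and bits are fair. -/
def outcomeMeasure (V : Type) [Fintype V] (Δ : ℕ) : Measure (Outcome V Δ) :=
  coinMeasure.prod (Measure.pi fun _ : V =>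
    (uniformOn (Set.univ : Set (Equiv.Perm (Fin Δ)))).prod coinMeasure)

section Network

variable {V : Type} {G : SimpleGraph V} {Δ : ℕ}

/-- The neighbour of `v` behind its port `i`, after the ports have been renumbered. -/
def nbr (P : PortNumbering G Δ) (ω : Outcome V Δ) (v : V) (i : Fin Δ) : V :=
  (P v ((ω.2 v).1 i) : G.neighborSet v)

theorem adj_nbr (P : PortNumbering G Δ) (ω : Outcome V Δ) (v : V) (i : Fin Δ) :
    G.Adj v (nbr P ω v i) :=
  (P v ((ω.2 v).1 i)).2

/-- The (renumbered) port which the neighbour of `v` behind port `i` uses for the edge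
to `v`. -/
def backPort (P : PortNumbering G Δ) (ω : Outcome V Δ) (v : V) (i : Fin Δ) : Fin Δ :=
  (ω.2 (nbr P ω v i)).1.symm ((P (nbr P ω v i)).symm ⟨v, (adj_nbr P ω v i).symm⟩)

end Network

/-! ### The LOCAL model -/

/-- A `T`-round randomized LOCAL algorithm with shared randomness for networks all of whose
nodes have `Δ` ports. All nodes run the same algorithm: the state of a node is initialised
from the shared and its private random bits; in round `k` it sends a message through every
port and updates its state from the messages it receives; after `T` rounds it labels each of
its ports by `true` (that is, `M`) or `false` (that is, `U`). States and messages are arbitrary;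
local computations are only required to be measurable. -/
structure LocalAlgorithm (Δ T : ℕ) where
  State : ℕ → Type
  Msg : ℕ → Type
  [mState : ∀ k, MeasurableSpace (State k)]
  [mMsg : ∀ k, MeasurableSpace (Msg k)]
  init : BitStream × BitStream → State 0
  send : ∀ k, State k → Fin Δ → Msg k
  receive : ∀ k, State k × (Fin Δ → Msg k) → State (k + 1)
  output : State T → Fin Δ → Bool
  measurable_init : Measurable init
  measurable_send : ∀ k, Measurable (send k)
  measurable_receive : ∀ k, Measurable (receive k)
  measurable_output : Measurable output

namespace LocalAlgorithm

variable {V : Type} {G : SimpleGraph V} {Δ T : ℕ}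

/-- The state of node `v` after `k` rounds. -/
def state (A : LocalAlgorithm Δ T) (P : PortNumbering G Δ) (ω : Outcome V Δ) :
    (k : ℕ) → V → A.State k
  | 0, v => A.init (ω.1, (ω.2 v).2)
  | k + 1, v => A.receive k (A.state P ω k v,
      fun i => A.send k (A.state P ω k (nbr P ω v i)) (backPort P ω v i))

/-- The label which node `v` gives to its port `i`. -/
def label (A : LocalAlgorithm Δ T) (P : PortNumbering G Δ) (ω : Outcome V Δ)
    (v : V) (i : Fin Δ) : Bool :=
  A.output (A.state P ω T v) i

/-- The half-edge `(v, e)` is grabbed by `v`: it is labelled `M`. -/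
def Grabs (A : LocalAlgorithm Δ T) (P : PortNumbering G Δ) (ω : Outcome V Δ)
    (v : V) (e : Sym2 V) : Prop :=
  ∃ i : Fin Δ, s(v, nbr P ω v i) = e ∧ A.label P ω v i = true

/-- The algorithm always solves `b`-grabbing: whatever the random choices are, each node
outputs `M` on exactly `b` of its ports. -/
def NoError (A : LocalAlgorithm Δ T) (P : PortNumbering G Δ) (b : ℕ) : Prop :=
  ∀ (ω : Outcome V Δ) (v : V),
    (Finset.univ.filter fun i : Fin Δ => A.label P ω v i = true).card = b

/-- The number of matched edges: those which are grabbed by both endpoints. -/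
def quality (A : LocalAlgorithm Δ T) (P : PortNumbering G Δ) (ω : Outcome V Δ) : ℕ :=
  {e : Sym2 V | e ∈ G.edgeSet ∧ ∀ v ∈ e, A.Grabs P ω v e}.ncard

/-- The badness `1 - 2q / (bn)` of a solution with `q` matched edges. -/
def badness [Fintype V] (A : LocalAlgorithm Δ T) (P : PortNumbering G Δ) (b : ℕ)
    (ω : Outcome V Δ) : ℝ :=
  1 - 2 * (A.quality P ω : ℝ) / ((b : ℝ) * (Fintype.card V : ℝ))

def expectedBadness [Fintype V] (A : LocalAlgorithm Δ T) (P : PortNumbering G Δ)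
    (b : ℕ) : ℝ :=
  ∫ ω, A.badness P b ω ∂(outcomeMeasure V Δ)

end LocalAlgorithm

/-! ### Views and preferred directions -/

/-- Radius-`k` views, as what a node can learn in `k` rounds: initially the shared and the own
random bits; and in each further round, for each port, the view of the neighbour behind it and
the port number of the edge at this neighbour. In a graph without cycles of length at most `2k`
this carries the same information as the radius-`k` ball around the node with its random bits
and port numbers, up to isomorphism. -/
def View (Δ : ℕ) : ℕ → Type
  | 0 => BitStream × BitStream
  | k + 1 => View Δ k × (Fin Δ → Fin Δ × View Δ k)

@[reducible] def viewMeasurableSpace (Δ : ℕ) : (k : ℕ) → MeasurableSpace (View Δ k)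
  | 0 => inferInstanceAs (MeasurableSpace (BitStream × BitStream))
  | k + 1 =>
    letI := viewMeasurableSpace Δ k
    inferInstanceAs (MeasurableSpace (View Δ k × (Fin Δ → Fin Δ × View Δ k)))

instance (Δ k : ℕ) : MeasurableSpace (View Δ k) := viewMeasurableSpace Δ k

section Preferred

variable {V : Type} {G : SimpleGraph V} {Δ T : ℕ}

/-- The radius-`k` view of node `v`. -/
def view (P : PortNumbering G Δ) (ω : Outcome V Δ) : (k : ℕ) → V → View Δ k
  | 0, v => (ω.1, (ω.2 v).2)
  | k + 1, v => (view P ω k v, fun i => (backPort P ω v i, view P ω k (nbr P ω v i)))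

/-- The conditional probability, given the radius-`k` view of `v`, that `A` outputs `M` on
port `i` of `v`. -/
def grabProb [Fintype V] (A : LocalAlgorithm Δ T) (P : PortNumbering G Δ) (k : ℕ) (v : V)
    (i : Fin Δ) : Outcome V Δ → ℝ :=
  (outcomeMeasure V Δ)[(fun ω => if A.label P ω v i = true then (1 : ℝ) else 0) |
    MeasurableSpace.comap (fun ω => view P ω k v) inferInstance]

/-- Port `i` is among the `b` ports with the largest values of `x`, ties being broken in
favour of the smallest port numbers: fewer than `b` ports come before `i`. -/
def IsPreferred (b : ℕ) (x : Fin Δ → ℝ) (i : Fin Δ) : Prop :=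
  {j : Fin Δ | x i < x j ∨ (x j = x i ∧ j < i)}.ncard < b

end Preferred

end Grabbing

end

noncomputable section

namespace Grabbing

/-! ### Partial averages over product spaces -/

section ProductSpace

variable {V N : Type*}

open Classical in
/-- The point which agrees with `η` on `I` and with `η'` elsewhere. -/
def glue (I : Set V) (η η' : V → N) : V → N := fun w => if w ∈ I then η w else η' w

theorem glue_of_mem {I : Set V} {w : V} (h : w ∈ I) (η η' : V → N) : glue I η η' w = η w :=
  if_pos h

theorem glue_of_notMem {I : Set V} {w : V} (h : w ∉ I) (η η' : V → N) :
    glue I η η' w = η' w :=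
  if_neg h

theorem dependsOn_glue {β : Type*} {F : (V → N) → β} {J : Set V} (hF : DependsOn F J)
    (I : Set V) (η : V → N) : DependsOn (fun η' => F (glue I η η')) (J \ I) := by
  intro x y h
  refine hF fun w hw => ?_
  by_cases hI : w ∈ I
  · rw [glue_of_mem hI, glue_of_mem hI]
  · rw [glue_of_notMem hI, glue_of_notMem hI, h w ⟨hw, hI⟩]

variable [MeasurableSpace N]

theorem measurable_glue (I : Set V) :
    Measurable fun p : (V → N) × (V → N) => glue I p.1 p.2 := by
  refine measurable_pi_lambda _ fun w => ?_
  by_cases h : w ∈ I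
  · simp only [glue_of_mem h]; fun_prop
  · simp only [glue_of_notMem h]; fun_prop

theorem measurable_glue_right (I : Set V) (η : V → N) : Measurable (glue I η) :=
  (measurable_glue I).comp measurable_prodMk_left

variable [Fintype V] (ν : Measure N) [IsProbabilityMeasure ν]

theorem map_glue (I : Set V) :
    ((Measure.pi fun _ : V => ν).prod (Measure.pi fun _ : V => ν)).map
      (fun p => glue I p.1 p.2) = Measure.pi fun _ : V => ν := by
  classical
  symm
  refine Measure.pi_eq fun s hs => ?_
  rw [Measure.map_apply (measurable_glue I) (MeasurableSet.univ_pi hs)]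
  have : (fun p : (V → N) × (V → N) => glue I p.1 p.2) ⁻¹' (Set.univ.pi s) =
      (Set.univ.pi fun w => if w ∈ I then s w else Set.univ) ×ˢ
        (Set.univ.pi fun w => if w ∈ I then Set.univ else s w) := by
    ext ⟨x, y⟩
    simp only [Set.mem_preimage, Set.mem_pi, Set.mem_univ, true_imp_iff, Set.mem_prod,
      ← forall_and]
    refine forall_congr' fun w => ?_
    by_cases h : w ∈ I <;> simp [glue, h]
  rw [this, Measure.prod_prod, Measure.pi_pi, Measure.pi_pi, ← Finset.prod_mul_distrib]
  refine Finset.prod_congr rfl fun w _ => ?_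
  by_cases h : w ∈ I <;> simp [h]

theorem integral_glue (I : Set V) {F : (V → N) → ℝ} (hF : Measurable F) :
    ∫ p, F (glue I p.1 p.2) ∂((Measure.pi fun _ : V => ν).prod (Measure.pi fun _ : V => ν)) =
      ∫ η, F η ∂(Measure.pi fun _ : V => ν) := by
  conv_rhs => rw [← map_glue ν I]
  rw [integral_map (measurable_glue I).aemeasurable hF.aestronglyMeasurable]

/-- Functions of disjoint sets of coordinates are independent. -/
theorem integral_mul_of_dependsOn {F G : (V → N) → ℝ} {I J : Set V} (hF : Measurable F)
    (hG : Measurable G) (hFI : DependsOn F I) (hGJ : DependsOn G J) (h : Disjoint I J) :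
    ∫ η, F η * G η ∂(Measure.pi fun _ : V => ν) =
      (∫ η, F η ∂(Measure.pi fun _ : V => ν)) * ∫ η, G η ∂(Measure.pi fun _ : V => ν) := by
  rw [← integral_glue ν I (F := fun η => F η * G η) (hF.mul hG), ← integral_prod_mul]
  congr 1 with p
  congr 1
  · exact hFI fun w hw => glue_of_mem hw _ _
  · exact hGJ fun w hw => glue_of_notMem (fun hI => h.le_bot ⟨hI, hw⟩) _ _

/-- The average of `F` over all coordinates outside `I`. -/
def partialAvg (I : Set V) (F : (V → N) → ℝ) (η : V → N) : ℝ :=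
  ∫ η', F (glue I η η') ∂(Measure.pi fun _ : V => ν)

omit [IsProbabilityMeasure ν] in
theorem dependsOn_partialAvg (I : Set V) (F : (V → N) → ℝ) :
    DependsOn (partialAvg ν I F) I := by
  intro x y h
  have : ∀ η', glue I x η' = glue I y η' := fun η' => funext fun w => by
    by_cases hw : w ∈ I
    · rw [glue_of_mem hw, glue_of_mem hw, h w hw]
    · rw [glue_of_notMem hw, glue_of_notMem hw]
  simp only [partialAvg, this]

theorem measurable_partialAvg (I : Set V) {F : (V → N) → ℝ} (hF : Measurable F) :
    Measurable (partialAvg ν I F) :=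
  ((hF.comp (measurable_glue I)).stronglyMeasurable.integral_prod_right').measurable

theorem integrable_of_bounds {Ω : Type*} [MeasurableSpace Ω] {P : Measure Ω} [IsFiniteMeasure P]
    {F : Ω → ℝ} (hF : Measurable F) (C : ℝ) (h : ∀ η, |F η| ≤ C) : Integrable F P :=
  Integrable.of_bound hF.aestronglyMeasurable C (ae_of_all _ h)

theorem integral_partialAvg (I : Set V) {F : (V → N) → ℝ} (hF : Measurable F) (C : ℝ)
    (h : ∀ η, |F η| ≤ C) :
    ∫ η, partialAvg ν I F η ∂(Measure.pi fun _ : V => ν) =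
      ∫ η, F η ∂(Measure.pi fun _ : V => ν) := by
  rw [← integral_glue ν I hF]
  refine (integral_prod (fun p => F (glue I p.1 p.2)) ?_).symm
  exact integrable_of_bounds (hF.comp (measurable_glue I)) C fun p => h _

theorem partialAvg_mul {F G : (V → N) → ℝ} {I J K : Set V} (hF : Measurable F)
    (hG : Measurable G) (hFI : DependsOn F I) (hGJ : DependsOn G J) (h : I ∩ J ⊆ K)
    (η : V → N) :
    partialAvg ν K (fun η => F η * G η) η = partialAvg ν K F η * partialAvg ν K G η := by
  refine integral_mul_of_dependsOn ν (hF.comp (measurable_glue_right K η))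
    (hG.comp (measurable_glue_right K η)) (dependsOn_glue hFI K η) (dependsOn_glue hGJ K η) ?_
  refine Set.disjoint_left.2 fun w hw hw' => hw.2 (h ⟨hw.1, hw'.1⟩)

theorem partialAvg_of_dependsOn {F : (V → N) → ℝ} {K : Set V} (hF : DependsOn F K) (η : V → N) :
    partialAvg ν K F η = F η := by
  have : ∀ η', F (glue K η η') = F η := fun η' => hF fun w hw => glue_of_mem hw _ _
  simp [partialAvg, this]

theorem partialAvg_mem_Icc {F : (V → N) → ℝ} (h : ∀ η, F η ∈ Set.Icc (0 : ℝ) 1) (K : Set V)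
    (η : V → N) : partialAvg ν K F η ∈ Set.Icc (0 : ℝ) 1 := by
  refine ⟨integral_nonneg fun η' => (h _).1, ?_⟩
  have := norm_integral_le_of_norm_le_const (μ := Measure.pi fun _ : V => ν) (C := 1)
    (f := fun η' => F (glue K η η'))
    (ae_of_all _ fun η' => by rw [Real.norm_of_nonneg (h _).1]; exact (h _).2)
  refine (le_abs_self _).trans (this.trans ?_)
  simp

/-- The fourth moment of a sum of bounded independent centred random variables. -/
theorem moments_sum_of_dependsOn {ι : Type*} {d : ι → (V → N) → ℝ} {K : ι → Set V}
    (hd : ∀ i, Measurable (d i)) (hb : ∀ i η, |d i η| ≤ 1)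
    (h0 : ∀ i, ∫ η, d i η ∂(Measure.pi fun _ : V => ν) = 0) (hK : ∀ i, DependsOn (d i) (K i))
    (hdisj : ∀ i j, i ≠ j → Disjoint (K i) (K j)) (s : Finset ι) :
    let W := ∑ i ∈ s, ∫ η, d i η ^ 2 ∂(Measure.pi fun _ : V => ν)
    ∫ η, (∑ i ∈ s, d i η) ∂(Measure.pi fun _ : V => ν) = 0 ∧
    ∫ η, (∑ i ∈ s, d i η) ^ 2 ∂(Measure.pi fun _ : V => ν) = W ∧
    ∫ η, (∑ i ∈ s, d i η) ^ 4 ∂(Measure.pi fun _ : V => ν) ≤ W + 3 * W ^ 2 := by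
  classical
  set π := Measure.pi fun _ : V => ν
  induction s using Finset.induction_on with
  | empty => simp
  | insert i s his ih =>
    obtain ⟨h1, h2, h4⟩ := ih
    set S : (V → N) → ℝ := fun η => ∑ j ∈ s, d j η with hS
    have hSm : Measurable S := Finset.measurable_fun_sum s fun j _ => hd j
    have hSb : ∀ η, |S η| ≤ s.card := fun η => by
      refine (Finset.abs_sum_le_sum_abs _ _).trans ?_
      simpa using Finset.sum_le_sum fun j (_ : j ∈ s) => hb j η
    have hSK : DependsOn S (⋃ j ∈ s, K j) := fun x y h =>
      Finset.sum_congr rfl fun j hj => hK j fun w hw => h w (Set.mem_biUnion hj hw)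
    have hdis : Disjoint (⋃ j ∈ s, K j) (K i) := by
      simp only [Set.disjoint_iUnion_left]
      exact fun j hj => hdisj j i (fun e => his (e ▸ hj))
    have hmul : ∀ a b : ℕ, ∫ η, S η ^ a * d i η ^ b ∂π = (∫ η, S η ^ a ∂π) * ∫ η, d i η ^ b ∂π :=
      fun a b => integral_mul_of_dependsOn ν (hSm.pow_const a) ((hd i).pow_const b)
        (fun x y h => by simp only [hSK h]) (fun x y h => by simp only [hK i h]) hdis
    have hint : ∀ a b : ℕ, Integrable (fun η => S η ^ a * d i η ^ b) π := fun a b => by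
      refine integrable_of_bounds ((hSm.pow_const a).mul ((hd i).pow_const b)) (s.card ^ a) ?_
      intro η
      rw [abs_mul, abs_pow, abs_pow]
      calc |S η| ^ a * |d i η| ^ b ≤ (s.card : ℝ) ^ a * 1 := by
            gcongr
            · exact hSb η
            · exact pow_le_one₀ (abs_nonneg _) (hb i η)
        _ = _ := mul_one _
    simp only [Finset.sum_insert his]
    set q := ∫ η, d i η ^ 2 ∂π with hq
    set W := ∑ j ∈ s, ∫ η, d j η ^ 2 ∂π with hW
    have m10 := hint 1 0
    have m01 := hint 0 1
    have m20 := hint 2 0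
    have m11 := hint 1 1
    have m02 := hint 0 2
    have m40 := hint 4 0
    have m31 := hint 3 1
    have m22 := hint 2 2
    have m13 := hint 1 3
    have m04 := hint 0 4
    have e01 : ∫ η, d i η ^ 1 ∂π = 0 := by simpa using h0 i
    have e10 : ∫ η, S η ^ 1 ∂π = 0 := by simpa using h1
    have q4 : ∫ η, d i η ^ 4 ∂π ≤ q := by
      refine integral_mono (by simpa using m04) (by simpa using m02) fun η => ?_
      have := (sq_le_one_iff_abs_le_one _).2 (hb i η)
      change d i η ^ 4 ≤ d i η ^ 2
      nlinarith [sq_nonneg (d i η)]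
    refine ⟨?_, ?_, ?_⟩
    · have : ∀ η, d i η + S η = S η ^ 1 * d i η ^ 0 + S η ^ 0 * d i η ^ 1 := fun η => by ring
      rw [show (fun η => d i η + ∑ j ∈ s, d j η) = fun η => d i η + S η from rfl]
      simp_rw [this]
      rw [integral_add m10 m01, hmul, hmul, e01, e10]; simp
    · have : ∀ η, (d i η + S η) ^ 2 =
          S η ^ 2 * d i η ^ 0 + 2 * (S η ^ 1 * d i η ^ 1) + S η ^ 0 * d i η ^ 2 := fun η => by ring
      rw [show (fun η => (d i η + ∑ j ∈ s, d j η) ^ 2) = fun η => (d i η + S η) ^ 2 from rfl]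
      simp_rw [this]
      rw [integral_add (m20.fun_add (m11.const_mul 2)) m02, integral_add m20 (m11.const_mul 2),
        integral_const_mul, hmul, hmul, hmul, e01, h2, ← hq]
      simp; ring
    · have : ∀ η, (d i η + S η) ^ 4 =
          S η ^ 4 * d i η ^ 0 + 4 * (S η ^ 3 * d i η ^ 1) + 6 * (S η ^ 2 * d i η ^ 2) +
            4 * (S η ^ 1 * d i η ^ 3) + S η ^ 0 * d i η ^ 4 := fun η => by ring
      rw [show (fun η => (d i η + ∑ j ∈ s, d j η) ^ 4) = fun η => (d i η + S η) ^ 4 from rfl]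
      simp_rw [this]
      rw [integral_add (((m40.fun_add (m31.const_mul 4)).fun_add (m22.const_mul 6)).fun_add (m13.const_mul 4))
          m04, integral_add ((m40.fun_add (m31.const_mul 4)).fun_add (m22.const_mul 6)) (m13.const_mul 4),
        integral_add (m40.fun_add (m31.const_mul 4)) (m22.const_mul 6),
        integral_add m40 (m31.const_mul 4), integral_const_mul, integral_const_mul,
        integral_const_mul, hmul, hmul, hmul, hmul, hmul, e01, e10, h2, ← hq]
      simp only [pow_zero, integral_const, probReal_univ, smul_eq_mul, mul_one, one_mul, mul_zero,
        zero_mul, add_zero]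
      nlinarith [h4, q4, sq_nonneg q]

end ProductSpace

/-! ### Rounding to the preferred ports -/

/-- Rounding a fractional point of the `b`-uniform hypersimplex to its `b` largest coordinates. -/
theorem sum_rounding_le {ι : Type*} [Fintype ι] [DecidableEq ι] {x : ι → ℝ} {B : Finset ι}
    (hx : ∀ i, x i ∈ Set.Icc (0 : ℝ) 1) (hne : B.Nonempty) (hsum : ∑ i, x i = B.card)
    (htop : ∀ i ∈ B, ∀ j ∉ B, x j ≤ x i) :
    ∑ i, (if i ∈ B then 1 - x i else x i) ≤ 2 * ∑ i, x i * (1 - x i) := by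
  obtain ⟨k, hk, hmin⟩ := B.exists_min_image x hne
  have h1 : ∑ i, (if i ∈ B then 1 - x i else x i) =
      ∑ i ∈ B, (1 - x i) + ∑ i ∈ Bᶜ, x i := by
    rw [← Finset.sum_add_sum_compl B]
    congr 1
    · exact Finset.sum_congr rfl fun i hi => if_pos hi
    · exact Finset.sum_congr rfl fun i hi => if_neg (Finset.mem_compl.1 hi)
  have h2 : ∑ i ∈ B, (1 - x i) = ∑ i ∈ Bᶜ, x i := by
    rw [Finset.sum_sub_distrib, Finset.sum_const, nsmul_one, ← hsum,
      ← Finset.sum_add_sum_compl B]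
    ring
  have h3 : x k * ∑ i ∈ B, (1 - x i) ≤ ∑ i ∈ B, x i * (1 - x i) := by
    rw [Finset.mul_sum]
    exact Finset.sum_le_sum fun i hi =>
      mul_le_mul_of_nonneg_right (hmin i hi) (by linarith [(hx i).2])
  have h4 : (1 - x k) * ∑ i ∈ Bᶜ, x i ≤ ∑ i ∈ Bᶜ, x i * (1 - x i) := by
    rw [Finset.mul_sum]
    refine Finset.sum_le_sum fun i hi => ?_
    rw [mul_comm]
    exact mul_le_mul_of_nonneg_left (by linarith [htop k hk i (Finset.mem_compl.1 hi)]) (hx i).1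
  rw [h1, ← Finset.sum_add_sum_compl B fun i => x i * (1 - x i)]
  rw [h2] at *
  linarith

theorem abs_sub_of_zero_or_one {x : ℝ} (hx : x = 0 ∨ x = 1) {f : ℝ}
    (hf : f ∈ Set.Icc (0 : ℝ) 1) : |f - x| = f + x - 2 * (f * x) := by
  rcases hx with rfl | rfl
  · rw [sub_zero, abs_of_nonneg hf.1]; ring
  · rw [abs_of_nonpos (by linarith [hf.2])]; ring

theorem zero_or_one_mem_Icc {x : ℝ} (hx : x = 0 ∨ x = 1) : x ∈ Set.Icc (0 : ℝ) 1 := by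
  rcases hx with rfl | rfl <;> simp

theorem abs_le_one_of_mem_Icc {x : ℝ} (hx : x ∈ Set.Icc (0 : ℝ) 1) : |x| ≤ 1 :=
  abs_le.2 ⟨by linarith [hx.1], hx.2⟩

section

variable {V N : Type*} [MeasurableSpace N] [Fintype V] (ν : Measure N) [IsProbabilityMeasure ν]

/-- Two conditionally independent labels can agree only if both are nearly determined. -/
theorem integral_partialAvg_mul_one_sub_le {X Y : (V → N) → ℝ} {J J' K : Set V}
    (hX : Measurable X) (hY : Measurable Y) (hX01 : ∀ η, X η = 0 ∨ X η = 1)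
    (hY01 : ∀ η, Y η = 0 ∨ Y η = 1) (hXJ : DependsOn X J) (hYJ : DependsOn Y J')
    (hK : J ∩ J' ⊆ K) :
    ∫ η, partialAvg ν K X η * (1 - partialAvg ν K X η) ∂(Measure.pi fun _ : V => ν) ≤
      ∫ η, |X η - Y η| ∂(Measure.pi fun _ : V => ν) := by
  have hXI := fun η => zero_or_one_mem_Icc (hX01 η)
  have hYI := fun η => zero_or_one_mem_Icc (hY01 η)
  have hfI := partialAvg_mem_Icc ν hXI K
  have hgI := partialAvg_mem_Icc ν hYI K
  have hfm := measurable_partialAvg ν K hX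
  have hgm := measurable_partialAvg ν K hY
  set f := partialAvg ν K X
  set g := partialAvg ν K Y
  set π := Measure.pi fun _ : V => ν
  have iX : Integrable X π := integrable_of_bounds hX 1 fun η => abs_le_one_of_mem_Icc (hXI η)
  have iY : Integrable Y π := integrable_of_bounds hY 1 fun η => abs_le_one_of_mem_Icc (hYI η)
  have iF : Integrable f π := integrable_of_bounds hfm 1 fun η => abs_le_one_of_mem_Icc (hfI η)
  have iG : Integrable g π := integrable_of_bounds hgm 1 fun η => abs_le_one_of_mem_Icc (hgI η)
  have bfg : ∀ a b : (V → N) → ℝ, (∀ η, a η ∈ Set.Icc (0 : ℝ) 1) →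
      (∀ η, b η ∈ Set.Icc (0 : ℝ) 1) → ∀ η, |a η * b η| ≤ 1 := fun a b ha hb η => by
    rw [abs_mul]
    exact mul_le_one₀ (abs_le_one_of_mem_Icc (ha η)) (abs_nonneg _)
      (abs_le_one_of_mem_Icc (hb η))
  have iXY : Integrable (fun η => X η * Y η) π :=
    integrable_of_bounds (hX.mul hY) 1 (bfg X Y hXI hYI)
  have iFG : Integrable (fun η => f η * g η) π :=
    integrable_of_bounds (hfm.mul hgm) 1 (bfg f g hfI hgI)
  have eX : ∫ η, f η ∂π = ∫ η, X η ∂π :=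
    integral_partialAvg ν K hX 1 fun η => abs_le_one_of_mem_Icc (hXI η)
  have eY : ∫ η, g η ∂π = ∫ η, Y η ∂π :=
    integral_partialAvg ν K hY 1 fun η => abs_le_one_of_mem_Icc (hYI η)
  have eXY : ∫ η, f η * g η ∂π = ∫ η, X η * Y η ∂π := by
    rw [← integral_partialAvg ν K (F := fun η => X η * Y η) (hX.mul hY) 1 (bfg X Y hXI hYI)]
    exact integral_congr_ae (ae_of_all _ fun η => (partialAvg_mul ν hX hY hXJ hYJ hK η).symm)
  have e1 : ∫ η, |X η - Y η| ∂π = ∫ η, (f η + g η - 2 * (f η * g η)) ∂π := by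
    simp_rw [fun η => abs_sub_of_zero_or_one (hY01 η) (hXI η)]
    rw [integral_sub (iX.fun_add iY) (iXY.const_mul 2), integral_add iX iY, integral_const_mul,
      integral_sub (iF.fun_add iG) (iFG.const_mul 2), integral_add iF iG, integral_const_mul,
      eX, eY, eXY]
  rw [e1]
  refine integral_mono ?_ ((iF.fun_add iG).sub (iFG.const_mul 2)) fun η => ?_
  · refine integrable_of_bounds (hfm.mul (hfm.const_sub 1)) 1 (bfg f (fun η => 1 - f η) hfI ?_)
    exact fun η => ⟨by linarith [(hfI η).2], by linarith [(hfI η).1]⟩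
  · change f η * (1 - f η) ≤ f η + g η - 2 * (f η * g η)
    nlinarith [(hfI η).1, (hfI η).2, (hgI η).1, (hgI η).2,
      mul_nonneg (mul_nonneg (hfI η).1 (hfI η).1) (sub_nonneg.2 (hgI η).2),
      mul_nonneg (mul_self_nonneg (1 - f η)) (hgI η).1]

/-- A labelling with `b` marked ports, in which the contributions of the ports are nearly
independent, is close to its preferred directions. -/
theorem sum_integral_abs_sub_preferred_le {ι : Type*} [Fintype ι] [DecidableEq ι] {b : ℕ}
    (hb : 1 ≤ b) {X Y : ι → (V → N) → ℝ} {J : Set V} {J' K : ι → Set V}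
    (hX : ∀ i, Measurable (X i)) (hY : ∀ i, Measurable (Y i))
    (hX01 : ∀ i η, X i η = 0 ∨ X i η = 1) (hY01 : ∀ i η, Y i η = 0 ∨ Y i η = 1)
    (hXJ : ∀ i, DependsOn (X i) J) (hYJ : ∀ i, DependsOn (Y i) (J' i))
    (hJK : ∀ i, J ∩ J' i ⊆ K i) (hK : ∀ i j, i ≠ j → Disjoint (K i) (K j))
    (hsum : ∀ η, ∑ i, X i η = b) {B : Finset ι} (hB : B.card = b)
    (htop : ∀ i ∈ B, ∀ j ∉ B, ∫ η, X j η ∂(Measure.pi fun _ : V => ν) ≤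
      ∫ η, X i η ∂(Measure.pi fun _ : V => ν)) :
    ∑ i, ∫ η, |(if i ∈ B then 1 else 0) - X i η| ∂(Measure.pi fun _ : V => ν) ≤
      26 * √b * ∑ i, ∫ η, |X i η - Y i η| ∂(Measure.pi fun _ : V => ν) := by
  set π := Measure.pi fun _ : V => ν
  have hXI := fun i η => zero_or_one_mem_Icc (hX01 i η)
  set f : ι → (V → N) → ℝ := fun i => partialAvg ν (K i) (X i)
  have hfI : ∀ i η, f i η ∈ Set.Icc (0 : ℝ) 1 := fun i => partialAvg_mem_Icc ν (hXI i) (K i)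
  have hfm : ∀ i, Measurable (f i) := fun i => measurable_partialAvg ν (K i) (hX i)
  have hfK : ∀ i, DependsOn (f i) (K i) := fun i => dependsOn_partialAvg ν (K i) (X i)
  set x : ι → ℝ := fun i => ∫ η, X i η ∂π with hx
  have iX : ∀ i, Integrable (X i) π := fun i =>
    integrable_of_bounds (hX i) 1 fun η => abs_le_one_of_mem_Icc (hXI i η)
  have iF : ∀ i, Integrable (f i) π := fun i =>
    integrable_of_bounds (hfm i) 1 fun η => abs_le_one_of_mem_Icc (hfI i η)
  have bmul : ∀ a b : (V → N) → ℝ, (∀ η, a η ∈ Set.Icc (0 : ℝ) 1) →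
      (∀ η, b η ∈ Set.Icc (0 : ℝ) 1) → ∀ η, |a η * b η| ≤ 1 := fun a b ha hb η => by
    rw [abs_mul]
    exact mul_le_one₀ (abs_le_one_of_mem_Icc (ha η)) (abs_nonneg _)
      (abs_le_one_of_mem_Icc (hb η))
  have iFX : ∀ i, Integrable (fun η => f i η * X i η) π := fun i =>
    integrable_of_bounds ((hfm i).mul (hX i)) 1 (bmul _ _ (hfI i) (hXI i))
  have iFF : ∀ i, Integrable (fun η => f i η * f i η) π := fun i =>
    integrable_of_bounds ((hfm i).mul (hfm i)) 1 (bmul _ _ (hfI i) (hfI i))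
  have ef : ∀ i, ∫ η, f i η ∂π = x i := fun i =>
    integral_partialAvg ν (K i) (hX i) 1 fun η => abs_le_one_of_mem_Icc (hXI i η)
  have efX : ∀ i, ∫ η, f i η * X i η ∂π = ∫ η, f i η * f i η ∂π := fun i => by
    rw [← integral_partialAvg ν (K i) (F := fun η => f i η * X i η) ((hfm i).mul (hX i)) 1
      (bmul _ _ (hfI i) (hXI i))]
    refine integral_congr_ae (ae_of_all _ fun η => ?_)
    change partialAvg ν (K i) (fun η => f i η * X i η) η = f i η * f i η
    rw [partialAvg_mul ν (hfm i) (hX i) (hfK i) (hXJ i) Set.inter_subset_left,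
      partialAvg_of_dependsOn ν (hfK i)]
  have hxI : ∀ i, x i ∈ Set.Icc (0 : ℝ) 1 := fun i => by
    rw [← ef i]
    refine ⟨integral_nonneg fun η => (hfI i η).1, ?_⟩
    simpa using integral_mono (iF i) (integrable_const (1 : ℝ)) fun η => (hfI i η).2
  have hxsum : ∑ i, x i = b := by
    rw [hx, ← integral_finsetSum _ fun i _ => iX i]
    simp [hsum]
  -- the total uncertainty of the labels
  set δ : ℝ := ∑ i, (x i - ∫ η, f i η * f i η ∂π) with hδ
  have hδi : ∀ i, ∫ η, f i η * (1 - f i η) ∂π = x i - ∫ η, f i η * f i η ∂π := fun i => by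
    rw [← ef i, ← integral_sub (iF i) (iFF i)]
    exact integral_congr_ae (ae_of_all _ fun η => by ring)
  have hδ0 : 0 ≤ δ := Finset.sum_nonneg fun i _ => by
    rw [← hδi]
    exact integral_nonneg fun η => mul_nonneg (hfI i η).1 (by linarith [(hfI i η).2])
  have hδle : δ ≤ ∑ i, ∫ η, |X i η - Y i η| ∂π := Finset.sum_le_sum fun i _ => by
    rw [← hδi]
    exact integral_partialAvg_mul_one_sub_le ν (hX i) (hY i) (hX01 i) (hY01 i) (hXJ i) (hYJ i)
      (hJK i)
  set d : ι → (V → N) → ℝ := fun i η => f i η - x i with hd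
  have hdm : ∀ i, Measurable (d i) := fun i => (hfm i).sub_const _
  have hdb : ∀ i η, |d i η| ≤ 1 := fun i η =>
    abs_le.2 ⟨by linarith [(hfI i η).1, (hxI i).2], by linarith [(hfI i η).2, (hxI i).1]⟩
  have hd0 : ∀ i, ∫ η, d i η ∂π = 0 := fun i => by
    rw [hd, integral_sub (iF i) (integrable_const _), ef i]; simp
  obtain ⟨-, hm2, hm4⟩ := moments_sum_of_dependsOn ν hdm hdb hd0
    (fun i a c h => by simp only [hd, hfK i h]) hK Finset.univ
  set W := ∑ i, ∫ η, d i η ^ 2 ∂π with hW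
  set S : (V → N) → ℝ := fun η => ∑ i, d i η with hS
  have hSm : Measurable S := Finset.measurable_fun_sum _ fun i _ => hdm i
  have hW0 : 0 ≤ W := Finset.sum_nonneg fun i _ => integral_nonneg fun η => sq_nonneg _
  have hWδ : W + δ = ∑ i, x i * (1 - x i) := by
    rw [hW, hδ, ← Finset.sum_add_distrib]
    refine Finset.sum_congr rfl fun i _ => ?_
    have : ∀ η, d i η ^ 2 = f i η * f i η - 2 * x i * f i η + x i ^ 2 := fun η => by
      simp only [hd]; ring
    simp_rw [this]
    have i2 : Integrable (fun η => f i η * f i η - 2 * x i * f i η) π :=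
      (iFF i).sub ((iF i).const_mul _)
    rw [integral_add i2 (integrable_const _),
      integral_sub (iFF i) ((iF i).const_mul _), integral_const_mul, ef i]
    simp; ring
  have hxx : ∑ i, x i * (1 - x i) ≤ b := by
    rw [← hxsum]
    exact Finset.sum_le_sum fun i _ => by nlinarith [(hxI i).1]
  have hWb : W ≤ b := by linarith
  have habs : ∫ η, |S η| ∂π ≤ 2 * δ := by
    have hle : ∀ η, |S η| ≤ ∑ i, (f i η + X i η - 2 * (f i η * X i η)) := fun η => by
      have : S η = ∑ i, (f i η - X i η) := by
        simp only [hS, hd, Finset.sum_sub_distrib, hsum, hxsum]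
      rw [this]
      refine (Finset.abs_sum_le_sum_abs _ _).trans (Finset.sum_le_sum fun i _ => ?_)
      rw [abs_sub_of_zero_or_one (hX01 i η) (hfI i η)]
    have hi : ∀ i, Integrable (fun η => f i η + X i η - 2 * (f i η * X i η)) π := fun i =>
      ((iF i).fun_add (iX i)).sub ((iFX i).const_mul 2)
    refine (integral_mono_of_nonneg (ae_of_all _ fun η => abs_nonneg _)
      (integrable_finsetSum _ fun i _ => hi i) (ae_of_all _ hle)).trans_eq ?_
    rw [integral_finsetSum _ fun i _ => hi i, hδ, Finset.mul_sum]
    refine Finset.sum_congr rfl fun i _ => ?_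
    rw [integral_sub ((iF i).fun_add (iX i)) ((iFX i).const_mul 2), integral_add (iF i) (iX i),
      integral_const_mul, efX i, ef i]
    change x i + x i - _ = _
    ring
  have hb1 : (1 : ℝ) ≤ b := by exact_mod_cast hb
  have hsb : √(b : ℝ) ^ 2 = b := Real.sq_sqrt (by linarith)
  have hsb1 : 1 ≤ √(b : ℝ) := Real.one_le_sqrt.2 hb1
  have hSb : ∀ η, |S η| ≤ (Finset.univ : Finset ι).card := fun η => by
    refine (Finset.abs_sum_le_sum_abs _ _).trans ?_
    simpa using Finset.sum_le_sum fun j (_ : j ∈ Finset.univ) => hdb j η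
  have iS1 : Integrable (fun η => |S η|) π :=
    integrable_of_bounds hSm.abs _ fun η => by rw [abs_abs]; exact hSb η
  have iSp : ∀ k, Integrable (fun η => S η ^ k) π := fun k =>
    integrable_of_bounds (hSm.pow_const k) ((Finset.univ : Finset ι).card ^ k) fun η => by
      rw [abs_pow]; exact pow_le_pow_left₀ (abs_nonneg _) (hSb η) k
  have hWle : W ≤ 12 * √b * δ := by
    have hpt : ∀ η, S η ^ 2 ≤ 3 * √b * |S η| + (9 * (b : ℝ))⁻¹ * S η ^ 4 := fun η => by
      set r := 3 * √(b : ℝ) with hr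
      have hr0 : 0 < r := by positivity
      have hr2 : 9 * (b : ℝ) = r ^ 2 := by rw [hr, mul_pow, hsb]; norm_num
      rw [hr2, ← sq_abs, ← Even.pow_abs (⟨2, rfl⟩ : Even 4)]
      set a := |S η|
      have ha : 0 ≤ a := abs_nonneg _
      rcases le_total a r with h | h
      · have : 0 ≤ (r ^ 2)⁻¹ * a ^ 4 := by positivity
        nlinarith
      · have : a ^ 2 ≤ (r ^ 2)⁻¹ * a ^ 4 := by
          rw [inv_mul_eq_div, le_div_iff₀ (by positivity)]
          nlinarith [pow_le_pow_left₀ hr0.le h 2, sq_nonneg a]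
        nlinarith [mul_nonneg hr0.le ha]
    have h1 := integral_mono (iSp 2) ((iS1.const_mul (3 * √(b : ℝ))).fun_add
      ((iSp 4).const_mul (9 * (b : ℝ))⁻¹)) hpt
    rw [integral_add (iS1.const_mul _) ((iSp 4).const_mul _), integral_const_mul,
      integral_const_mul] at h1
    have h2 : W ≤ 3 * √b * (2 * δ) + (9 * (b : ℝ))⁻¹ * (W + 3 * W ^ 2) := by
      rw [← hm2]
      refine h1.trans ?_
      rw [hm2]
      gcongr
    have h3 : (9 * (b : ℝ))⁻¹ * (W + 3 * W ^ 2) ≤ W / 2 := by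
      rw [inv_mul_eq_div, div_le_iff₀ (by linarith)]
      nlinarith
    linarith
  have hround : ∑ i, ∫ η, |(if i ∈ B then 1 else 0) - X i η| ∂π ≤ 2 * ∑ i, x i * (1 - x i) := by
    refine le_trans (le_of_eq (Finset.sum_congr rfl fun i _ => ?_))
      (sum_rounding_le hxI (Finset.card_pos.1 (by omega)) (by rw [hxsum, hB]) htop)
    by_cases hi : i ∈ B
    · simp only [hi, if_true]
      have : ∀ η, |1 - X i η| = 1 - X i η := fun η => abs_of_nonneg (by linarith [(hXI i η).2])
      simp_rw [this]
      rw [integral_sub (integrable_const _) (iX i)]; simp [hx]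
    · simp only [hi, if_false]
      exact integral_congr_ae (ae_of_all _ fun η => by
        simp only [zero_sub, abs_neg]; exact abs_of_nonneg (hXI i η).1)
  calc _ ≤ 2 * (W + δ) := by rw [hWδ]; exact hround
    _ ≤ 26 * √b * δ := by nlinarith
    _ ≤ _ := by gcongr

end

/-! ### Balls in graphs of large girth -/

section Girth

variable {V : Type} {G : SimpleGraph V}

/-- Two different paths with the same ends close a cycle. -/
theorem path_eq_of_lt_egirth {v w : V} {p q : G.Walk v w} (hp : p.IsPath) (hq : q.IsPath)
    (h : ((p.length + q.length : ℕ) : ℕ∞) < G.egirth) : p = q := by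
  by_contra hne
  obtain ⟨u', v', p', q', hp', hq', hc⟩ := hp.exists_isCycle_of_ne hq hne
  have h1 := SimpleGraph.egirth_le_length hc
  rw [SimpleGraph.Walk.length_append, SimpleGraph.Walk.length_reverse] at h1
  exact absurd (h.trans_le h1)
    (by exact_mod_cast (add_le_add (SimpleGraph.Walk.length_le_of_isSubwalk hp')
      (SimpleGraph.Walk.length_le_of_isSubwalk hq')).not_gt)

theorem support_eq_of_lt_egirth {v w w' : V} {p : G.Walk v w} {q : G.Walk v w'} (e : w = w')
    (hp : p.IsPath) (hq : q.IsPath) (h : ((p.length + q.length : ℕ) : ℕ∞) < G.egirth) :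
    p.support = q.support := by
  subst e
  rw [path_eq_of_lt_egirth hp hq h]

theorem snd_eq_of_adj {u v w : V} {p : G.Walk u w} (hp : p.IsPath) (huv : G.Adj v u)
    (hv : v ∈ p.support) (h : ((p.length + 1 : ℕ) : ℕ∞) < G.egirth) : p.snd = v := by
  classical
  have hlen := p.length_takeUntil_le_length hv
  have e := path_eq_of_lt_egirth (hp.takeUntil hv) (q := .cons huv.symm .nil)
    ((SimpleGraph.Walk.cons_isPath_iff _ _).2 ⟨.nil, by simpa using huv.ne'⟩)
    (lt_of_le_of_lt (by
      rw [SimpleGraph.Walk.length_cons, SimpleGraph.Walk.length_nil]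
      exact_mod_cast by omega) h)
  have hsnd := congrArg SimpleGraph.Walk.snd e
  rw [SimpleGraph.Walk.snd_takeUntil huv.ne] at hsnd
  simpa using hsnd

/-- The nodes at distance at most `k` from `v`. -/
def ball (G : SimpleGraph V) (k : ℕ) (v : V) : Set V := {w | ∃ p : G.Walk v w, p.length ≤ k}

theorem self_mem_ball (k : ℕ) (v : V) : v ∈ ball G k v := ⟨.nil, k.zero_le⟩

theorem ball_mono {k l : ℕ} (h : k ≤ l) (v : V) : ball G k v ⊆ ball G l v :=
  fun _ ⟨p, hp⟩ => ⟨p, hp.trans h⟩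

theorem ball_subset_ball_succ {u v : V} (h : G.Adj v u) (k : ℕ) :
    ball G k u ⊆ ball G (k + 1) v :=
  fun _ ⟨p, hp⟩ => ⟨.cons h p, by simpa using hp⟩

theorem exists_path_of_mem_ball {k : ℕ} {v w : V} (h : w ∈ ball G k v) :
    ∃ p : G.Walk v w, p.IsPath ∧ p.length ≤ k := by
  classical
  obtain ⟨p, hp⟩ := h
  exact ⟨p.bypass, p.bypass_isPath, p.length_bypass_le_length.trans hp⟩

/-- A path from a neighbour `u` of `v` to a node which is further from `v` than from `u`
extends to a path from `v`. -/
theorem exists_cons_isPath {k : ℕ} {u v w : V} (h : G.Adj v u) (hu : w ∈ ball G k u)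
    (hv : w ∉ ball G k v) :
    ∃ p : G.Walk u w, p.length ≤ k ∧ (SimpleGraph.Walk.cons h p).IsPath := by
  classical
  obtain ⟨p, hp, hk⟩ := exists_path_of_mem_ball hu
  refine ⟨p, hk, (SimpleGraph.Walk.cons_isPath_iff h p).2 ⟨hp, fun hmem => hv ?_⟩⟩
  exact ⟨p.dropUntil v hmem, (p.length_dropUntil_le_length hmem).trans hk⟩

/-- There are no odd cycles around an edge. -/
theorem ball_inter_ball_subset {k : ℕ} {u v : V} (hG : ((2 * k + 3 : ℕ) : ℕ∞) < G.egirth)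
    (h : G.Adj v u) :
    ball G (k + 1) v ∩ ball G (k + 1) u ⊆ ball G k v ∪ ball G k u := by
  rintro w ⟨hv, hu⟩
  by_contra hw
  rw [Set.mem_union, not_or] at hw
  have far : ∀ {x : V} (p : G.Walk x w), w ∉ ball G k x → k < p.length := fun p hx =>
    lt_of_not_ge fun hle => hx ⟨p, hle⟩
  obtain ⟨p, hp, hpk⟩ := exists_path_of_mem_ball hv
  classical
  obtain ⟨q, hq, hqk⟩ := exists_path_of_mem_ball hu
  have hvq : v ∉ q.support := fun hmem => hw.1
    ⟨q.dropUntil v hmem, by have := SimpleGraph.Walk.length_dropUntil_lt_length hmem h.ne; omega⟩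
  have hq' := (SimpleGraph.Walk.cons_isPath_iff h q).2 ⟨hq, hvq⟩
  have hlen : p.length + (SimpleGraph.Walk.cons h q).length ≤ 2 * k + 3 := by
    rw [SimpleGraph.Walk.length_cons]; omega
  have := path_eq_of_lt_egirth hp hq' (lt_of_le_of_lt (by exact_mod_cast hlen) hG)
  have h1 := congrArg SimpleGraph.Walk.length this
  have h2 := far q hw.2
  rw [SimpleGraph.Walk.length_cons] at h1
  omega

theorem ball_diff_disjoint {k : ℕ} {u u' v : V} (hG : ((2 * k + 3 : ℕ) : ℕ∞) < G.egirth)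
    (h : G.Adj v u) (h' : G.Adj v u') (hne : u ≠ u') :
    Disjoint (ball G k u \ ball G k v) (ball G k u' \ ball G k v) := by
  refine Set.disjoint_left.2 fun w hw hw' => hne ?_
  obtain ⟨p, hpk, hp⟩ := exists_cons_isPath h hw.1 hw.2
  obtain ⟨q, hqk, hq⟩ := exists_cons_isPath h' hw'.1 hw.2
  have hlen : (SimpleGraph.Walk.cons h p).length + (SimpleGraph.Walk.cons h' q).length ≤
      2 * k + 3 := by
    rw [SimpleGraph.Walk.length_cons, SimpleGraph.Walk.length_cons]; omega
  have := path_eq_of_lt_egirth hp hq (lt_of_le_of_lt (by exact_mod_cast hlen) hG)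
  have h1 := congrArg SimpleGraph.Walk.snd this
  simpa using h1

end Girth

/-! ### Walks along ports -/

section PortWalk

variable {V : Type} {G : SimpleGraph V} {Δ : ℕ} (P : PortNumbering G Δ) (ω : Outcome V Δ)

@[simp]
theorem nbr_backPort (v : V) (i : Fin Δ) : nbr P ω (nbr P ω v i) (backPort P ω v i) = v := by
  rw [nbr, backPort, Equiv.apply_symm_apply, Equiv.apply_symm_apply]

theorem nbr_injective (v : V) : Function.Injective (nbr P ω v) := fun i j h => by
  have := (P v).injective (Subtype.ext h)
  exact (ω.2 v).1.injective this

theorem nbr_surj {v u : V} (h : G.Adj v u) : ∃ i, nbr P ω v i = u :=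
  ⟨(ω.2 v).1.symm ((P v).symm ⟨u, h⟩), by rw [nbr, Equiv.apply_symm_apply, Equiv.apply_symm_apply]⟩

@[simp]
theorem backPort_backPort (v : V) (i : Fin Δ) :
    backPort P ω (nbr P ω v i) (backPort P ω v i) = i :=
  nbr_injective P ω v <| by
    have h := nbr_backPort P ω (nbr P ω v i) (backPort P ω v i)
    have hv := nbr_backPort P ω v i
    generalize backPort P ω (nbr P ω v i) (backPort P ω v i) = j at *
    rw [hv] at h
    exact h

/-- The node reached from `v` along a list of ports. -/
def follow : V → List (Fin Δ) → V
  | v, [] => v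
  | v, i :: l => follow (nbr P ω v i) l

/-- The walk from `v` along a list of ports. -/
def portWalk : (v : V) → (l : List (Fin Δ)) → G.Walk v (follow P ω v l)
  | _, [] => .nil
  | v, i :: l => .cons (adj_nbr P ω v i) (portWalk (nbr P ω v i) l)

@[simp]
theorem length_portWalk (v : V) (l : List (Fin Δ)) : (portWalk P ω v l).length = l.length := by
  induction l generalizing v with
  | nil => rfl
  | cons i l ih => exact (SimpleGraph.Walk.length_cons _ _).trans (congrArg (· + 1) (ih _))

theorem support_portWalk_cons (v : V) (i : Fin Δ) (l : List (Fin Δ)) :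
    (portWalk P ω v (i :: l)).support = v :: (portWalk P ω (nbr P ω v i) l).support :=
  rfl

theorem support_portWalk_eq (v : V) (l : List (Fin Δ)) :
    ∃ L, (portWalk P ω v l).support = v :: L :=
  ⟨_, (SimpleGraph.Walk.cons_tail_support _).symm⟩

/-- The list of ports `l` from `v` does not start with `s`, and never turns back. -/
def Forward : Option (Fin Δ) → V → List (Fin Δ) → Prop
  | _, _, [] => True
  | s, v, i :: l => s ≠ some i ∧ Forward (some (backPort P ω v i)) (nbr P ω v i) l

theorem Forward.none {s : Option (Fin Δ)} {v : V} {l : List (Fin Δ)} (h : Forward P ω s v l) :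
    Forward P ω none v l := by
  cases l with
  | nil => trivial
  | cons i l => exact ⟨nofun, h.2⟩

theorem Forward.isPath {s : Option (Fin Δ)} {v : V} {l : List (Fin Δ)} (h : Forward P ω s v l)
    (hG : ((l.length + 1 : ℕ) : ℕ∞) < G.egirth) : (portWalk P ω v l).IsPath := by
  induction l generalizing v s with
  | nil => exact .nil
  | cons i l ih =>
    have hp := ih h.2 (lt_of_le_of_lt (by simp) hG)
    refine (SimpleGraph.Walk.cons_isPath_iff _ _).2 ⟨hp, fun hmem => ?_⟩
    cases l with
    | nil => exact (adj_nbr P ω v i).ne (List.mem_singleton.1 hmem)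
    | cons j l =>
      have hsnd := snd_eq_of_adj hp (adj_nbr P ω v i) hmem (lt_of_le_of_lt (by
        rw [length_portWalk]; exact_mod_cast by simp) hG)
      have : nbr P ω (nbr P ω v i) j = v :=
        (SimpleGraph.Walk.snd_cons (portWalk P ω (nbr P ω (nbr P ω v i) j) l)
          (adj_nbr P ω (nbr P ω v i) j)).symm.trans hsnd
      have hji : backPort P ω v i = j :=
        nbr_injective P ω (nbr P ω v i) (by rw [this, nbr_backPort])
      exact h.2.1 (congrArg some hji)

theorem support_portWalk_injective {v : V} {l l' : List (Fin Δ)}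
    (h : (portWalk P ω v l).support = (portWalk P ω v l').support) : l = l' := by
  induction l generalizing v l' with
  | nil =>
    have := congrArg List.length h
    simp only [SimpleGraph.Walk.length_support, length_portWalk, List.length_nil] at this
    exact (List.length_eq_zero_iff.1 (by omega)).symm
  | cons i l ih =>
    cases l' with
    | nil =>
      have := congrArg List.length h
      simp [SimpleGraph.Walk.length_support] at this
    | cons j l' =>
      rw [support_portWalk_cons, support_portWalk_cons] at h
      have h' := (List.cons.inj h).2
      obtain ⟨L, hL⟩ := support_portWalk_eq P ω (nbr P ω v i) l
      obtain ⟨L', hL'⟩ := support_portWalk_eq P ω (nbr P ω v j) l'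
      have hij : i = j := by
        have := h'
        rw [hL, hL'] at this
        exact nbr_injective P ω v (List.cons.inj this).1
      subst hij
      rw [ih h']

theorem follow_injOn {k : ℕ} (hG : ((2 * k + 3 : ℕ) : ℕ∞) < G.egirth) {v : V}
    {l l' : List (Fin Δ)} (hl : Forward P ω none v l) (hl' : Forward P ω none v l')
    (hk : l.length = k + 1) (hk' : l'.length = k + 1) (e : follow P ω v l = follow P ω v l') :
    l = l' := by
  refine support_portWalk_injective P ω (support_eq_of_lt_egirth e ?_ ?_ ?_)
  · exact hl.isPath P ω (lt_of_le_of_lt (by exact_mod_cast by omega) hG)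
  · exact hl'.isPath P ω (lt_of_le_of_lt (by exact_mod_cast by omega) hG)
  · refine lt_of_le_of_lt ?_ hG
    rw [length_portWalk, length_portWalk]
    exact_mod_cast by omega

theorem follow_notMem_ball {k : ℕ} (hG : ((2 * k + 3 : ℕ) : ℕ∞) < G.egirth) {v : V}
    {l : List (Fin Δ)} (hl : Forward P ω none v l) (hk : l.length = k + 1) :
    follow P ω v l ∉ ball G k v := fun h => by
  obtain ⟨p, hp, hpk⟩ := exists_path_of_mem_ball h
  have e := path_eq_of_lt_egirth hp
    (hl.isPath P ω (lt_of_le_of_lt (by exact_mod_cast by omega) hG)) (lt_of_le_of_lt (by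
      rw [length_portWalk]; exact_mod_cast by omega) hG)
  have := congrArg SimpleGraph.Walk.length e
  rw [length_portWalk] at this
  omega

end PortWalk

/-! ### Views -/

section Views

/-- Substituting a measurable discrete parameter. -/
theorem measurable_of_countable_param {C Ω β : Type*} [MeasurableSpace C] [Countable C]
    [MeasurableSingletonClass C] [MeasurableSpace Ω] [MeasurableSpace β] {f : C → Ω → β}
    (hf : ∀ c, Measurable (f c)) {g : Ω → C} (hg : Measurable g) :
    Measurable fun ω => f (g ω) ω :=
  (measurable_from_prod_countable_right (f := fun p : C × Ω => f p.1 p.2) hf).comp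
    (hg.prodMk measurable_id)

instance (Δ : ℕ) : MeasurableSingletonClass (Equiv.Perm (Fin Δ)) := ⟨fun _ => trivial⟩

theorem measurable_symm_apply {Δ : ℕ} (c : Fin Δ) :
    Measurable fun σ : Equiv.Perm (Fin Δ) => σ.symm c := fun _ _ => trivial

/-- The private random choices of a node. -/
abbrev NodeRandomness (Δ : ℕ) : Type := Equiv.Perm (Fin Δ) × BitStream

/-- The law of the private random choices of a node. -/
def nodeMeasure (Δ : ℕ) : Measure (NodeRandomness Δ) :=
  (uniformOn (Set.univ : Set (Equiv.Perm (Fin Δ)))).prod coinMeasure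

instance : IsProbabilityMeasure coinMeasure := by
  unfold coinMeasure; infer_instance

instance (Δ : ℕ) : IsProbabilityMeasure (nodeMeasure Δ) := by
  unfold nodeMeasure; infer_instance

variable {V : Type} {G : SimpleGraph V} {Δ T : ℕ} (P : PortNumbering G Δ)

theorem measurable_perm (v : V) : Measurable fun ω : Outcome V Δ => (ω.2 v).1 :=
  measurable_fst.comp ((measurable_pi_apply v).comp measurable_snd)

theorem measurable_comp_nbr {β : Type*} [MeasurableSpace β] {f : V → Outcome V Δ → β}
    (hf : ∀ u, Measurable (f u)) (v : V) (i : Fin Δ) :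
    Measurable fun ω => f (nbr P ω v i) ω :=
  measurable_of_countable_param (f := fun (σ : Equiv.Perm (Fin Δ)) ω => f (P v (σ i)) ω)
    (fun _ => hf _) (measurable_perm v)

theorem measurable_backPort (v : V) (i : Fin Δ) : Measurable fun ω => backPort P ω v i :=
  measurable_of_countable_param
    (f := fun (σ : Equiv.Perm (Fin Δ)) ω => (ω.2 (P v (σ i) : V)).1.symm
      ((P (P v (σ i) : V)).symm ⟨v, (P v (σ i)).2.symm⟩))
    (fun _ => (measurable_symm_apply _).comp (measurable_perm _)) (measurable_perm v)

theorem measurable_view (k : ℕ) (v : V) : Measurable fun ω => view P ω k v := by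
  induction k generalizing v with
  | zero =>
    exact measurable_fst.prodMk
      (measurable_snd.comp ((measurable_pi_apply v).comp measurable_snd))
  | succ k ih =>
    exact (ih v).prodMk (measurable_pi_lambda _ fun i =>
      (measurable_backPort P v i).prodMk (measurable_comp_nbr P ih v i))

theorem nbr_congr {ω ω' : Outcome V Δ} {v : V} (h : ω.2 v = ω'.2 v) (i : Fin Δ) :
    nbr P ω v i = nbr P ω' v i := by
  rw [nbr, nbr, h]

theorem backPort_congr {ω ω' : Outcome V Δ} {v : V} {i : Fin Δ} (h : ω.2 v = ω'.2 v)
    (h' : ω.2 (nbr P ω v i) = ω'.2 (nbr P ω v i)) : backPort P ω v i = backPort P ω' v i := by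
  have e := nbr_congr P h i
  have key : ∀ (u : V) (hu : G.Adj v u) (u' : V) (hu' : G.Adj v u'), u = u' →
      ω.2 u = ω'.2 u → (ω.2 u).1.symm ((P u).symm ⟨v, hu.symm⟩) =
        (ω'.2 u').1.symm ((P u').symm ⟨v, hu'.symm⟩) := by
    rintro u hu u' hu' rfl h
    rw [h]
  exact key _ (adj_nbr P ω v i) _ (adj_nbr P ω' v i) e h'

/-- The radius-`k` view of `v` is determined by the random choices within distance `k`. -/
theorem view_congr {k : ℕ} {v : V} {ω ω' : Outcome V Δ} (hs : ω.1 = ω'.1)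
    (h : ∀ w ∈ ball G k v, ω.2 w = ω'.2 w) : view P ω k v = view P ω' k v := by
  induction k generalizing v with
  | zero =>
    change (ω.1, (ω.2 v).2) = (ω'.1, (ω'.2 v).2)
    rw [hs, h v (self_mem_ball 0 v)]
  | succ k ih =>
    have hv := h v (self_mem_ball _ v)
    have hn : ∀ i, ∀ w ∈ ball G k (nbr P ω v i), ω.2 w = ω'.2 w := fun i w hw =>
      h w (ball_subset_ball_succ (adj_nbr P ω v i) k hw)
    refine Prod.ext (ih fun w hw => h w (ball_mono k.le_succ v hw)) (funext fun i => ?_)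
    refine Prod.ext (backPort_congr P hv (hn i _ (self_mem_ball k _))) ?_
    change view P ω k (nbr P ω v i) = view P ω' k (nbr P ω' v i)
    rw [ih (hn i), nbr_congr P hv i]

namespace LocalAlgorithm

variable (A : LocalAlgorithm Δ T)

attribute [instance] LocalAlgorithm.mState LocalAlgorithm.mMsg

/-- The state of a node as a function of its view. -/
def stateOfView : (k : ℕ) → View Δ k → A.State k
  | 0, w => A.init w
  | k + 1, w => A.receive k (stateOfView k w.1,
      fun i => A.send k (stateOfView k (w.2 i).2) (w.2 i).1)

theorem measurable_stateOfView (k : ℕ) : Measurable (A.stateOfView k) := by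
  induction k with
  | zero => exact A.measurable_init
  | succ k ih =>
    refine (A.measurable_receive k).comp ((ih.comp measurable_fst).prodMk
      (measurable_pi_lambda _ fun i => ?_))
    have h1 : Measurable fun w : View Δ (k + 1) => w.2 i :=
      (measurable_pi_apply i).comp measurable_snd
    exact measurable_of_countable_param (f := fun j (w : View Δ (k + 1)) =>
      A.send k (A.stateOfView k (w.2 i).2) j)
      (fun j => (measurable_pi_apply j).comp ((A.measurable_send k).comp
        (ih.comp (measurable_snd.comp h1)))) (measurable_fst.comp h1)

theorem state_eq (ω : Outcome V Δ) (k : ℕ) (v : V) :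
    A.state P ω k v = A.stateOfView k (view P ω k v) := by
  induction k generalizing v with
  | zero => rfl
  | succ k ih => simp only [state, ih]; rfl

/-- The label of port `i` as a function of the view. -/
def labelOfView (w : View Δ T) (i : Fin Δ) : Bool := A.output (A.stateOfView T w) i

theorem label_eq (ω : Outcome V Δ) (v : V) (i : Fin Δ) :
    A.label P ω v i = A.labelOfView (view P ω T v) i := by
  rw [label, state_eq]; rfl

theorem measurable_labelOfView (i : Fin Δ) : Measurable fun w => A.labelOfView w i :=
  (measurable_pi_apply i).comp (A.measurable_output.comp (A.measurable_stateOfView T))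

/-- The indicator that port `i` is labelled `M`, as a function of the view. -/
def markOfView (w : View Δ T) (i : Fin Δ) : ℝ := if A.labelOfView w i = true then 1 else 0

theorem measurable_markOfView (i : Fin Δ) : Measurable fun w => A.markOfView w i :=
  Measurable.ite (A.measurable_labelOfView i (measurableSet_singleton true)) measurable_const
    measurable_const

/-- The indicator that `v` labels its port `i` by `M`. -/
def mark (ω : Outcome V Δ) (v : V) (i : Fin Δ) : ℝ := if A.label P ω v i = true then 1 else 0

theorem mark_eq (ω : Outcome V Δ) (v : V) (i : Fin Δ) :
    A.mark P ω v i = A.markOfView (view P ω T v) i := by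
  rw [mark, label_eq]; rfl

theorem mark_zero_or_one (ω : Outcome V Δ) (v : V) (i : Fin Δ) :
    A.mark P ω v i = 0 ∨ A.mark P ω v i = 1 := by
  unfold mark; split <;> simp

theorem measurable_mark (v : V) (i : Fin Δ) : Measurable fun ω => A.mark P ω v i := by
  simp only [mark_eq]
  exact (A.measurable_markOfView i).comp (measurable_view P T v)

/-- The algorithm that gathers the radius-`k` view and labels the ports according to it. -/
def ofView (k : ℕ) (out : View Δ k → Fin Δ → Bool) (hout : Measurable out) :
    LocalAlgorithm Δ k where
  State := View Δ
  Msg j := Fin Δ × View Δ j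
  mState _ := inferInstance
  mMsg _ := inferInstance
  init w := w
  send _ w i := (i, w)
  receive _ w := w
  output := out
  measurable_init := measurable_id
  measurable_send _ := measurable_pi_lambda _ fun _ => measurable_const.prodMk measurable_id
  measurable_receive _ := measurable_id
  measurable_output := hout

theorem ofView_label (k : ℕ) (out : View Δ k → Fin Δ → Bool) (hout : Measurable out)
    (ω : Outcome V Δ) (v : V) (i : Fin Δ) :
    (ofView k out hout).label P ω v i = out (view P ω k v) i := by
  have : ∀ (j : ℕ) (v : V), (ofView k out hout).state P ω j v = view P ω j v := by
    intro j
    induction j with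
    | zero => intro v; rfl
    | succ j ih => intro v; simp only [state, ih]; rfl
  rw [label, this]; rfl

end LocalAlgorithm

end Views

/-! ### Extending views by fresh randomness -/

section Extension

variable {Δ : ℕ}

/-- Extends a radius-`k` view by the random choices `r` of the nodes at distance `k + 1`, which
are indexed by the ports that lead to them. Behind the port `s`, if any, the entry `q` is used
instead. -/
def extendView : (k : ℕ) → Option (Fin Δ) → (Fin Δ → Fin Δ × View Δ k) → View Δ k →
    (List (Fin Δ) → NodeRandomness Δ) → View Δ (k + 1)
  | 0, s, q, w, r => (w, fun i => if s = some i then q i else ((r [i]).1.symm i, (w.1, (r [i]).2)))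
  | k + 1, s, q, w, r => (w, fun i => if s = some i then q i else
      ((w.2 i).1, extendView k (some (w.2 i).1) (fun _ => (i, w.1)) (w.2 i).2
        fun l => r (i :: l)))

theorem measurable_extendView (k : ℕ) (s : Option (Fin Δ)) :
    Measurable fun p : (Fin Δ → Fin Δ × View Δ k) × View Δ k × (List (Fin Δ) → NodeRandomness Δ) =>
      extendView k s p.1 p.2.1 p.2.2 := by
  induction k generalizing s with
  | zero =>
    refine (measurable_fst.comp measurable_snd).prodMk (measurable_pi_lambda _ fun i => ?_)
    by_cases h : s = some i
    · simp only [h, if_true]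
      exact (measurable_pi_apply i).comp measurable_fst
    · simp only [h, if_false]
      have hr : Measurable fun p : (Fin Δ → Fin Δ × View Δ 0) × View Δ 0 ×
          (List (Fin Δ) → NodeRandomness Δ) => p.2.2 [i] :=
        (measurable_pi_apply [i]).comp (measurable_snd.comp measurable_snd)
      exact ((measurable_symm_apply i).comp (measurable_fst.comp hr)).prodMk
        ((measurable_fst.comp (measurable_fst.comp measurable_snd)).prodMk
          (measurable_snd.comp hr))
  | succ k ih =>
    refine (measurable_fst.comp measurable_snd).prodMk (measurable_pi_lambda _ fun i => ?_)
    by_cases h : s = some i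
    · simp only [h, if_true]
      exact (measurable_pi_apply i).comp measurable_fst
    · simp only [h, if_false]
      have hw : Measurable fun p : (Fin Δ → Fin Δ × View Δ (k + 1)) × View Δ (k + 1) ×
          (List (Fin Δ) → NodeRandomness Δ) => p.2.1 := measurable_fst.comp measurable_snd
      have hi : Measurable fun p : (Fin Δ → Fin Δ × View Δ (k + 1)) × View Δ (k + 1) ×
          (List (Fin Δ) → NodeRandomness Δ) => p.2.1.2 i :=
        (measurable_pi_apply i).comp (measurable_snd.comp hw)
      refine (measurable_fst.comp hi).prodMk ?_
      refine measurable_of_countable_param (f := fun j (p : (Fin Δ → Fin Δ × View Δ (k + 1)) ×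
        View Δ (k + 1) × (List (Fin Δ) → NodeRandomness Δ)) =>
          extendView k (some j) (fun _ => (i, p.2.1.1)) (p.2.1.2 i).2 fun l => p.2.2 (i :: l))
        (fun j => (ih (some j)).comp (Measurable.prodMk ?_ (Measurable.prodMk ?_ ?_)))
        (measurable_fst.comp hi)
      · exact measurable_pi_lambda _ fun _ =>
          measurable_const.prodMk (measurable_fst.comp hw)
      · exact measurable_snd.comp hi
      · exact measurable_pi_lambda _ fun l =>
          (measurable_pi_apply (i :: l)).comp (measurable_snd.comp measurable_snd)

variable {V : Type} {G : SimpleGraph V} (P : PortNumbering G Δ)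

/-- The number, before the renumbering, of the port through which the node at the end of the
list of ports is entered. -/
def entryPort (ω : Outcome V Δ) : V → List (Fin Δ) → Option (Fin Δ)
  | _, [] => none
  | v, [i] => some ((P (nbr P ω v i)).symm ⟨v, (adj_nbr P ω v i).symm⟩)
  | v, i :: j :: l => entryPort ω (nbr P ω v i) (j :: l)

/-- The random choices at the node at the end of a list of ports, with the renumbering composed
such that the entry port is renumbered as if it were the last port of the list. -/
def endRandomness (c : Option (Fin Δ)) (l : List (Fin Δ)) (x : NodeRandomness Δ) :
    NodeRandomness Δ :=
  match c, l.getLast? with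
  | some c, some i => ((Equiv.swap i c)⁻¹ * x.1, x.2)
  | _, _ => x

theorem extendView_view (ω : Outcome V Δ) (k : ℕ) (v : V) (s : Option (Fin Δ))
    (q : Fin Δ → Fin Δ × View Δ k) (r : List (Fin Δ) → NodeRandomness Δ)
    (hq : ∀ i, s = some i → q i = (backPort P ω v i, view P ω k (nbr P ω v i)))
    (hr : ∀ l, l.length = k + 1 → Forward P ω s v l →
      r l = endRandomness (entryPort P ω v l) l (ω.2 (follow P ω v l))) :
    extendView k s q (view P ω k v) r = view P ω (k + 1) v := by
  induction k generalizing v s r with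
  | zero =>
    refine Prod.ext rfl (funext fun i => ?_)
    change (if s = some i then q i else _) = (backPort P ω v i, view P ω 0 (nbr P ω v i))
    split_ifs with h
    · exact hq i h
    · rw [hr [i] rfl ⟨h, trivial⟩]
      refine Prod.ext ?_ rfl
      change ((Equiv.swap i _)⁻¹ * (ω.2 (nbr P ω v i)).1).symm i = _
      rw [← Equiv.Perm.inv_def, mul_inv_rev, inv_inv, Equiv.Perm.mul_apply, Equiv.swap_apply_left]
      rfl
  | succ k ih =>
    refine Prod.ext rfl (funext fun i => ?_)
    change (if s = some i then q i else _) = (backPort P ω v i, view P ω (k + 1) (nbr P ω v i))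
    split_ifs with h
    · exact hq i h
    · refine Prod.ext rfl ?_
      refine ih (nbr P ω v i) (some (backPort P ω v i)) _ _ ?_ ?_
      · rintro j hj
        obtain rfl := Option.some.inj hj
        rw [nbr_backPort, backPort_backPort]
        rfl
      · intro l hl hf
        rw [hr (i :: l) (by simp [hl]) ⟨h, hf⟩]
        obtain ⟨j, l, rfl⟩ := List.exists_cons_of_length_eq_add_one hl
        simp only [entryPort, follow, endRandomness, List.getLast?_cons_cons]

/-- Only the randomness behind forward walks is used. -/
theorem extendView_congr (ω : Outcome V Δ) (k : ℕ) (v : V) (s : Option (Fin Δ))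
    (q : Fin Δ → Fin Δ × View Δ k) {r r' : List (Fin Δ) → NodeRandomness Δ}
    (hr : ∀ l, l.length = k + 1 → Forward P ω s v l → r l = r' l) :
    extendView k s q (view P ω k v) r = extendView k s q (view P ω k v) r' := by
  induction k generalizing v s r r' with
  | zero =>
    refine Prod.ext rfl (funext fun i => ?_)
    change (if s = some i then q i else _) = (if s = some i then q i else _)
    split_ifs with h
    · rfl
    · rw [hr [i] rfl ⟨h, trivial⟩]
  | succ k ih =>
    refine Prod.ext rfl (funext fun i => ?_)
    change (if s = some i then q i else _) = (if s = some i then q i else _)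
    split_ifs with h
    · rfl
    · refine Prod.ext rfl ?_
      exact ih (nbr P ω v i) (some (backPort P ω v i)) _ fun l hl hf =>
        hr (i :: l) (by simp [hl]) ⟨h, hf⟩

end Extension

/-! ### The law of a view given a smaller view -/

section Law

variable {Δ : ℕ}

theorem measurePreserving_uniformOn_univ {α : Type*} [Finite α] [MeasurableSpace α]
    [DiscreteMeasurableSpace α] (e : α ≃ α) :
    MeasurePreserving e (uniformOn (Set.univ : Set α)) (uniformOn Set.univ) := by
  have := Fintype.ofFinite α
  refine ⟨fun _ _ => MeasurableSet.of_discrete, Measure.ext fun s hs => ?_⟩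
  rw [Measure.map_apply (fun _ _ => MeasurableSet.of_discrete) hs, uniformOn_univ, uniformOn_univ,
    ← e.image_symm_eq_preimage, Measure.count_injective_image e.symm.injective]

instance (Δ : ℕ) : DiscreteMeasurableSpace (Equiv.Perm (Fin Δ)) := ⟨fun _ => trivial⟩

theorem measurePreserving_endRandomness (c : Option (Fin Δ)) (l : List (Fin Δ)) :
    MeasurePreserving (endRandomness c l) (nodeMeasure Δ) (nodeMeasure Δ) := by
  unfold endRandomness
  split
  · next c i _ =>
    exact (measurePreserving_uniformOn_univ (Equiv.mulLeft (Equiv.swap i c)⁻¹)).prod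
      (MeasurePreserving.id _)
  · exact MeasurePreserving.id _

variable {V : Type} {G : SimpleGraph V} (P : PortNumbering G Δ)

theorem follow_congr {ω ω' : Outcome V Δ} {k : ℕ} {v : V}
    (h : ∀ w ∈ ball G k v, ω.2 w = ω'.2 w) {l : List (Fin Δ)} (hl : l.length = k + 1) :
    follow P ω v l = follow P ω' v l ∧ entryPort P ω v l = entryPort P ω' v l ∧
      ∀ s, Forward P ω s v l → Forward P ω' s v l := by
  induction l generalizing k v with
  | nil => cases hl
  | cons i l ih =>
    have hv := h v (self_mem_ball k v)
    have hn := nbr_congr P hv i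
    cases l with
    | nil =>
      refine ⟨hn, ?_, fun s hs => ⟨hs.1, trivial⟩⟩
      have key : ∀ (u : V) (hu : G.Adj v u) (u' : V) (hu' : G.Adj v u'), u = u' →
          (P u).symm ⟨v, hu.symm⟩ = (P u').symm ⟨v, hu'.symm⟩ := by
        rintro u hu u' hu' rfl
        rfl
      exact congrArg some (key _ (adj_nbr P ω v i) _ (adj_nbr P ω' v i) hn)
    | cons j l =>
      obtain ⟨k, rfl⟩ : ∃ k', k = k' + 1 := ⟨l.length, by simpa using hl.symm⟩
      have hb : ∀ w ∈ ball G k (nbr P ω v i), ω.2 w = ω'.2 w := fun w hw =>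
        h w (ball_subset_ball_succ (adj_nbr P ω v i) k hw)
      obtain ⟨h1, h2, h3⟩ := ih hb (by simpa using hl)
      have hp := backPort_congr P hv (hb _ (self_mem_ball k _))
      refine ⟨?_, ?_, fun s hs => ⟨hs.1, ?_⟩⟩
      · rw [follow, h1, hn, ← follow]
      · rw [entryPort, h2, hn, ← entryPort]
      · rw [← hp, ← hn]
        exact h3 _ hs.2

variable [Fintype V]

theorem outcomeMeasure_eq :
    outcomeMeasure V Δ = coinMeasure.prod (Measure.pi fun _ : V => nodeMeasure Δ) := rfl

/-- The law of independent random choices for all lists of ports. -/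
def freshMeasure (Δ : ℕ) : Measure (List (Fin Δ) → NodeRandomness Δ) :=
  Measure.infinitePi fun _ => nodeMeasure Δ

instance (Δ : ℕ) : IsProbabilityMeasure (freshMeasure Δ) := by
  unfold freshMeasure; infer_instance

/-- The average of a function of the radius-`k + 1` view, given the radius-`k` view. -/
def viewAvg (k : ℕ) (p : Fin Δ) (F : View Δ (k + 1) → ℝ) (w : View Δ k) : ℝ :=
  ∫ r, F (extendView k none (fun _ => (p, w)) w r) ∂freshMeasure Δ

theorem measurable_viewAvg (k : ℕ) (p : Fin Δ) {F : View Δ (k + 1) → ℝ} (hF : Measurable F) :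
    Measurable (viewAvg k p F) := by
  have h : Measurable fun x : View Δ k × (List (Fin Δ) → NodeRandomness Δ) =>
      F (extendView k none (fun _ => (p, x.1)) x.1 x.2) := by
    refine hF.comp ((measurable_extendView k none).comp (Measurable.prodMk ?_ measurable_id))
    exact measurable_pi_lambda _ fun _ => measurable_const.prodMk measurable_fst
  exact (h.stronglyMeasurable.integral_prod_right').measurable

/-- In a graph of large girth, the random choices outside the radius-`k` ball of a node enter its
radius-`k + 1` view as fresh random choices. -/
theorem integral_view_glue {k : ℕ} (hG : ((2 * k + 3 : ℕ) : ℕ∞) < G.egirth) (p : Fin Δ)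
    {F : View Δ (k + 1) → ℝ} (hF : Measurable F) (σ : BitStream) (η : V → NodeRandomness Δ)
    (v : V) :
    ∫ η', F (view P (σ, glue (ball G k v) η η') (k + 1) v)
        ∂(Measure.pi fun _ : V => nodeMeasure Δ) =
      viewAvg k p F (view P (σ, η) k v) := by
  classical
  set ω : Outcome V Δ := (σ, η)
  set Λ := {l : List (Fin Δ) // l.length = k + 1 ∧ Forward P ω none v l}
  have x₀ : NodeRandomness Δ := (1, fun _ => false)
  set e : (Λ → NodeRandomness Δ) → List (Fin Δ) → NodeRandomness Δ := fun y l =>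
    if h : l.length = k + 1 ∧ Forward P ω none v l then y ⟨l, h⟩ else x₀ with he
  have hem : Measurable e := measurable_pi_lambda _ fun l => by
    by_cases h : l.length = k + 1 ∧ Forward P ω none v l
    · simp only [he, h, and_self, dif_pos]; exact measurable_pi_apply _
    · simp only [he, h, dif_neg, not_false_iff]; exact measurable_const
  set w := view P ω k v
  set q : Fin Δ → Fin Δ × View Δ k := fun _ => (p, w)
  set g : (Λ → NodeRandomness Δ) → ℝ := fun y => F (extendView k none q w (e y)) with hg
  have hgm : Measurable g := hF.comp ((measurable_extendView k none).comp
    (measurable_const.prodMk (measurable_const.prodMk hem)))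
  -- the random choices outside the ball, by the lists of ports leading to them
  set Φ : (V → NodeRandomness Δ) → Λ → NodeRandomness Δ := fun η' l =>
    endRandomness (entryPort P ω v l.1) l.1 (η' (follow P ω v l.1)) with hΦ
  have hΦm : MeasurePreserving Φ (Measure.pi fun _ : V => nodeMeasure Δ)
      (Measure.infinitePi fun _ : Λ => nodeMeasure Δ) := by
    have hΦ' : Φ = (fun y l => endRandomness (entryPort P ω v l.1) l.1 (y l)) ∘
      fun (η' : V → NodeRandomness Δ) (l : Λ) => η' (follow P ω v l.1) := rfl
    have hm : ∀ l : Λ, Measurable (endRandomness (entryPort P ω v l.1) l.1) := fun l =>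
      (measurePreserving_endRandomness _ _).measurable
    have hmm : Measurable fun (y : Λ → NodeRandomness Δ) (l : Λ) =>
        endRandomness (entryPort P ω v l.1) l.1 (y l) :=
      measurable_pi_lambda _ fun l => (hm l).comp (measurable_pi_apply l)
    have hf : Measurable fun (η' : V → NodeRandomness Δ) (l : Λ) => η' (follow P ω v l.1) :=
      measurable_pi_lambda _ fun l => measurable_pi_apply _
    refine ⟨hmm.comp hf, ?_⟩
    rw [hΦ', ← Measure.map_map hmm hf, ← Measure.infinitePi_eq_pi,
      Measure.map_infinitePi_infinitePi_of_inj (P := fun _ : V => nodeMeasure Δ)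
        (f := fun l : Λ => follow P ω v l.1), Measure.infinitePi_map_pi _ hm]
    · simp only [(measurePreserving_endRandomness _ _).map_eq]
    · exact fun l l' h => Subtype.ext
        (follow_injOn P ω hG l.2.2 l'.2.2 l.2.1 l'.2.1 h)
  set Ψ : (List (Fin Δ) → NodeRandomness Δ) → Λ → NodeRandomness Δ := fun r l => r l.1 with hΨ
  have hΨm : MeasurePreserving Ψ (freshMeasure Δ)
      (Measure.infinitePi fun _ : Λ => nodeMeasure Δ) :=
    ⟨measurable_pi_lambda _ fun l => measurable_pi_apply _,
      Measure.map_infinitePi_infinitePi_of_inj (P := fun _ : List (Fin Δ) => nodeMeasure Δ)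
        Subtype.val_injective⟩
  have h1 : ∀ η', F (view P (σ, glue (ball G k v) η η') (k + 1) v) = g (Φ η') := by
    intro η'
    set ω' : Outcome V Δ := (σ, glue (ball G k v) η η') with hω'
    have hcongr : ∀ u ∈ ball G k v, ω'.2 u = ω.2 u := fun u hu => glue_of_mem hu _ _
    have hview : view P ω' k v = w := view_congr P rfl hcongr
    rw [hg]
    refine congrArg F (Eq.symm ?_)
    rw [← hview]
    refine extendView_view P ω' k v none q (e (Φ η')) nofun fun l hl hf => ?_
    obtain ⟨c1, c2, c3⟩ := follow_congr P hcongr hl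
    have hf' := c3 _ hf
    have hnot := follow_notMem_ball P ω hG hf' hl
    simp only [he, hl, hf', and_self, dif_pos, hΦ]
    rw [c1, c2]
    refine congrArg _ (Eq.symm ?_)
    exact glue_of_notMem hnot η η'
  have h2 : ∀ r, F (extendView k none q w r) = g (Ψ r) := fun r => by
    rw [hg]
    refine congrArg F (extendView_congr P ω k v none q fun l hl hf => ?_)
    simp only [he, hl, hf, and_self, dif_pos, hΨ]
  rw [viewAvg]
  simp_rw [h1]
  rw [integral_congr_ae (ae_of_all _ h2), ← integral_map hΦm.measurable.aemeasurable
    hgm.aestronglyMeasurable, hΦm.map_eq, ← hΨm.map_eq, integral_map hΨm.measurable.aemeasurable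
    hgm.aestronglyMeasurable]

end Law

/-! ### Preferred ports -/

section Preferred

variable {Δ : ℕ}

open Classical in
/-- The set of the `b` preferred ports. -/
def preferredPorts (b : ℕ) (x : Fin Δ → ℝ) : Finset (Fin Δ) :=
  Finset.univ.filter fun i => IsPreferred b x i

theorem mem_preferredPorts {b : ℕ} {x : Fin Δ → ℝ} {i : Fin Δ} :
    i ∈ preferredPorts b x ↔ IsPreferred b x i := by
  simp [preferredPorts]

/-- The number of ports that come before `i`. -/
def portRank (x : Fin Δ → ℝ) (i : Fin Δ) : ℕ :=
  {j : Fin Δ | x i < x j ∨ (x j = x i ∧ j < i)}.ncard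

theorem portRank_lt_portRank {x : Fin Δ → ℝ} {i j : Fin Δ}
    (h : x j < x i ∨ (x i = x j ∧ i < j)) : portRank x i < portRank x j := by
  refine Set.ncard_lt_ncard (Set.ssubset_iff_exists.2 ⟨fun k hk => ?_, i, h, ?_⟩)
    (Set.toFinite _)
  · simp only [Set.mem_ofPred_eq] at hk ⊢
    rcases hk with hk | ⟨hk, hk'⟩ <;> rcases h with h | ⟨h, h'⟩
    · exact .inl (h.trans hk)
    · exact .inl (h ▸ hk)
    · exact .inl (hk ▸ h)
    · exact .inr ⟨hk.trans h, hk'.trans h'⟩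
  · simp

theorem portRank_injective (x : Fin Δ → ℝ) : Function.Injective (portRank x) := by
  intro i j h
  by_contra hne
  rcases lt_trichotomy (x i) (x j) with h1 | h1 | h1
  · exact (portRank_lt_portRank (.inl h1)).ne' h
  · rcases lt_or_gt_of_ne hne with h2 | h2
    · exact (portRank_lt_portRank (.inr ⟨h1, h2⟩)).ne h
    · exact (portRank_lt_portRank (.inr ⟨h1.symm, h2⟩)).ne' h
  · exact (portRank_lt_portRank (.inl h1)).ne h

theorem portRank_lt (x : Fin Δ → ℝ) (i : Fin Δ) : portRank x i < Δ := by
  have : {j : Fin Δ | x i < x j ∨ (x j = x i ∧ j < i)} ⊂ Set.univ :=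
    Set.ssubset_univ_iff.2 fun h => by
      have : i ∈ {j : Fin Δ | x i < x j ∨ (x j = x i ∧ j < i)} := h ▸ Set.mem_univ i
      simp at this
  have h := Set.ncard_lt_ncard this (Set.toFinite _)
  rwa [Set.ncard_univ, Nat.card_eq_fintype_card, Fintype.card_fin] at h

theorem card_preferredPorts {b : ℕ} (hb : b ≤ Δ) (x : Fin Δ → ℝ) :
    (preferredPorts b x).card = b := by
  classical
  have hinj : Function.Injective fun i => (⟨portRank x i, portRank_lt x i⟩ : Fin Δ) :=
    fun i j h => portRank_injective x (congrArg Fin.val h)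
  let e : Fin Δ ≃ Fin Δ := Equiv.ofBijective _ (Finite.injective_iff_bijective.1 hinj)
  have h1 : (preferredPorts b x).card =
      (Finset.univ.filter fun j : Fin Δ => (j : ℕ) < b).card := by
    refine Finset.card_equiv e fun i => ?_
    rw [mem_preferredPorts, Finset.mem_filter]
    exact ⟨fun h => ⟨Finset.mem_univ _, h⟩, fun h => h.2⟩
  rw [h1, Fin.card_filter_val_lt, min_eq_right hb]

theorem le_of_mem_preferredPorts {b : ℕ} {x : Fin Δ → ℝ} {i j : Fin Δ}
    (hi : i ∈ preferredPorts b x) (hj : j ∉ preferredPorts b x) : x j ≤ x i := by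
  by_contra h
  rw [mem_preferredPorts] at hi hj
  exact hj (lt_trans (portRank_lt_portRank (.inl (not_le.1 h))) hi)

theorem measurableSet_isPreferred {Ω : Type*} [MeasurableSpace Ω] {x : Fin Δ → Ω → ℝ}
    (hx : ∀ i, Measurable (x i)) (b : ℕ) (i : Fin Δ) :
    MeasurableSet {ω | IsPreferred b (fun j => x j ω) i} := by
  classical
  have h : ∀ ω, {j : Fin Δ | x i ω < x j ω ∨ (x j ω = x i ω ∧ j < i)}.ncard =
      ∑ j, if x i ω < x j ω ∨ (x j ω = x i ω ∧ j < i) then 1 else 0 := fun ω => by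
    rw [Set.ncard_eq_toFinset_card', Finset.card_eq_sum_ones, Finset.sum_boole,
      Finset.sum_const]
    simp
  simp only [IsPreferred, h]
  refine measurableSet_lt (Finset.measurable_fun_sum _ fun j _ => ?_) measurable_const
  refine Measurable.ite ?_ measurable_const measurable_const
  exact (measurableSet_lt (hx i) (hx j)).union
    ((measurableSet_eq_fun (hx j) (hx i)).inter (MeasurableSet.const _))

end Preferred

/-! ### Badness as a number of mismatched half-edges -/

namespace LocalAlgorithm

section Badness

variable {V : Type} {G : SimpleGraph V} {Δ T : ℕ} (A : LocalAlgorithm Δ T)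
  (P : PortNumbering G Δ)

/-- The mark which the node `u` gives to its edge to `v`. -/
def markTo (ω : Outcome V Δ) {u v : V} (h : G.Adj v u) : ℝ :=
  A.mark P ω u ((ω.2 u).1.symm ((P u).symm ⟨v, h.symm⟩))

/-- The mark at the other end of the edge behind port `i` of `v`. -/
def coMark (ω : Outcome V Δ) (v : V) (i : Fin Δ) : ℝ :=
  A.mark P ω (nbr P ω v i) (backPort P ω v i)

theorem coMark_eq_markTo {ω : Outcome V Δ} {v u : V} (h : G.Adj v u) {i : Fin Δ}
    (e : nbr P ω v i = u) : A.coMark P ω v i = A.markTo P ω h := by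
  subst e
  rfl

theorem measurable_markTo {u v : V} (h : G.Adj v u) : Measurable fun ω => A.markTo P ω h :=
  measurable_of_countable_param (f := fun (σ : Equiv.Perm (Fin Δ)) ω =>
    A.mark P ω u (σ.symm ((P u).symm ⟨v, h.symm⟩)))
    (fun _ => A.measurable_mark P u _) (measurable_perm u)

theorem measurable_coMark (v : V) (i : Fin Δ) : Measurable fun ω => A.coMark P ω v i :=
  measurable_of_countable_param (f := fun (σ : Equiv.Perm (Fin Δ)) ω =>
    A.markTo P ω (P v (σ i)).2) (fun _ => A.measurable_markTo P _) (measurable_perm v)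

theorem coMark_zero_or_one (ω : Outcome V Δ) (v : V) (i : Fin Δ) :
    A.coMark P ω v i = 0 ∨ A.coMark P ω v i = 1 :=
  A.mark_zero_or_one P ω _ _

theorem grabs_iff (ω : Outcome V Δ) (v : V) (i : Fin Δ) :
    A.Grabs P ω v s(v, nbr P ω v i) ↔ A.label P ω v i = true := by
  refine ⟨fun ⟨j, hj, h⟩ => ?_, fun h => ⟨i, rfl, h⟩⟩
  have : nbr P ω v j = nbr P ω v i := Sym2.congr_right.1 hj
  rwa [← nbr_injective P ω v this]

theorem mark_mul_coMark (ω : Outcome V Δ) (v : V) (i : Fin Δ)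
    [Decidable (s(v, nbr P ω v i) ∈ {e : Sym2 V | e ∈ G.edgeSet ∧ ∀ v ∈ e, A.Grabs P ω v e})] :
    A.mark P ω v i * A.coMark P ω v i =
      if s(v, nbr P ω v i) ∈ {e : Sym2 V | e ∈ G.edgeSet ∧ ∀ v ∈ e, A.Grabs P ω v e}
        then 1 else 0 := by
  have h1 := A.grabs_iff P ω v i
  have h2 := A.grabs_iff P ω (nbr P ω v i) (backPort P ω v i)
  rw [nbr_backPort, Sym2.eq_swap] at h2
  have h3 : s(v, nbr P ω v i) ∈ {e : Sym2 V | e ∈ G.edgeSet ∧ ∀ v ∈ e, A.Grabs P ω v e} ↔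
      A.label P ω v i = true ∧ A.label P ω (nbr P ω v i) (backPort P ω v i) = true := by
    rw [← h1, ← h2]
    refine ⟨fun h => ⟨h.2 _ (Sym2.mem_mk_left _ _), h.2 _ (Sym2.mem_mk_right _ _)⟩,
      fun h => ⟨adj_nbr P ω v i, fun w hw => ?_⟩⟩
    rcases Sym2.mem_iff.1 hw with rfl | rfl
    exacts [h.1, h.2]
  simp only [h3, mark, coMark]
  split_ifs <;> simp_all

theorem sum_mark {b : ℕ} (hA : A.NoError P b) (ω : Outcome V Δ) (v : V) :
    ∑ i, A.mark P ω v i = b := by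
  simp only [mark, Finset.sum_boole, hA ω v]

variable [Fintype V]

/-- Passing to the other end of the edges does not change a sum over all half-edges. -/
theorem sum_halfEdges_swap (ω : Outcome V Δ) (h : V → Fin Δ → ℝ) :
    ∑ v, ∑ i, h (nbr P ω v i) (backPort P ω v i) = ∑ v, ∑ i, h v i := by
  rw [← Fintype.sum_prod_type', ← Fintype.sum_prod_type']
  let f : V × Fin Δ → V × Fin Δ := fun x => (nbr P ω x.1 x.2, backPort P ω x.1 x.2)
  have hf : Function.Involutive f := fun x =>
    Prod.ext (nbr_backPort P ω _ _) (backPort_backPort P ω _ _)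
  exact Equiv.sum_comp hf.toPerm fun x => h x.1 x.2

theorem sum_mark_mul_coMark (ω : Outcome V Δ) :
    ∑ v, ∑ i, A.mark P ω v i * A.coMark P ω v i = 2 * (A.quality P ω : ℝ) := by
  classical
  set M : Set (Sym2 V) := {e : Sym2 V | e ∈ G.edgeSet ∧ ∀ v ∈ e, A.Grabs P ω v e} with hM
  let d : V × Fin Δ → G.Dart := fun x => ⟨(x.1, nbr P ω x.1 x.2), adj_nbr P ω x.1 x.2⟩
  have hd : Function.Bijective d := by
    constructor
    · rintro ⟨v, i⟩ ⟨w, j⟩ h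
      have h' := congrArg SimpleGraph.Dart.toProd h
      simp only [d, Prod.mk.injEq] at h'
      obtain ⟨rfl, h'⟩ := h'
      rw [nbr_injective P ω v h']
    · rintro ⟨⟨v, w⟩, h⟩
      obtain ⟨i, hi⟩ := nbr_surj P ω h
      exact ⟨(v, i), by simp only [d, hi]⟩
  have hmaps : ((Finset.univ.filter fun x : G.Dart => x.edge ∈ M : Finset G.Dart) :
      Set G.Dart).MapsTo SimpleGraph.Dart.edge M.toFinset := fun x hx => by
    simpa using hx
  calc ∑ v, ∑ i, A.mark P ω v i * A.coMark P ω v i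
      = ∑ x : V × Fin Δ, if (d x).edge ∈ M then (1 : ℝ) else 0 := by
        rw [← Fintype.sum_prod_type']
        exact Finset.sum_congr rfl fun x _ => A.mark_mul_coMark P ω x.1 x.2
    _ = ∑ x : G.Dart, if x.edge ∈ M then (1 : ℝ) else 0 :=
        hd.sum_comp fun x : G.Dart => if x.edge ∈ M then (1 : ℝ) else 0
    _ = ((Finset.univ.filter fun x : G.Dart => x.edge ∈ M).card : ℝ) := by
        rw [Finset.sum_boole]
    _ = ((∑ e ∈ M.toFinset, 2 : ℕ) : ℝ) := by
        rw [Finset.card_eq_sum_card_fiberwise hmaps]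
        congr 1
        refine Finset.sum_congr rfl fun e he => ?_
        have heM : e ∈ M := Set.mem_toFinset.1 he
        rw [← G.dart_edge_fiber_card e heM.1, Finset.filter_filter]
        congr 1
        ext x
        simp only [Finset.mem_filter, Finset.mem_univ, true_and]
        exact ⟨fun h => h.2, fun h => ⟨h ▸ heM, h⟩⟩
    _ = 2 * (A.quality P ω : ℝ) := by
        rw [Finset.sum_const, quality, ← hM, Set.ncard_eq_toFinset_card', smul_eq_mul]
        push_cast
        ring

/-- The number of mismatched half-edges. -/
def mismatch (ω : Outcome V Δ) : ℝ := ∑ v, ∑ i, |A.mark P ω v i - A.coMark P ω v i|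

theorem mismatch_eq {b : ℕ} (hA : A.NoError P b) (ω : Outcome V Δ) :
    A.mismatch P ω = 2 * (b * Fintype.card V) - 4 * A.quality P ω := by
  have h1 : ∀ v i, |A.mark P ω v i - A.coMark P ω v i| =
      A.mark P ω v i + A.coMark P ω v i - 2 * (A.mark P ω v i * A.coMark P ω v i) := fun v i =>
    abs_sub_of_zero_or_one (A.coMark_zero_or_one P ω v i)
      (zero_or_one_mem_Icc (A.mark_zero_or_one P ω v i))
  have h2 : ∑ v, ∑ i, A.mark P ω v i = b * Fintype.card V := by
    simp [A.sum_mark P hA ω, mul_comm]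
  have h3 : ∑ v, ∑ i, A.coMark P ω v i = b * Fintype.card V := by
    rw [← h2]; exact sum_halfEdges_swap P ω fun v i => A.mark P ω v i
  simp only [mismatch, h1, Finset.sum_sub_distrib, Finset.sum_add_distrib, ← Finset.mul_sum]
  rw [h2, h3, A.sum_mark_mul_coMark P ω]
  ring

theorem badness_eq {b : ℕ} (hb : 1 ≤ b) [Nonempty V] (hA : A.NoError P b) (ω : Outcome V Δ) :
    A.badness P b ω = (2 * (b * Fintype.card V : ℝ))⁻¹ * A.mismatch P ω := by
  have h : (b * Fintype.card V : ℝ) ≠ 0 := by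
    have : 0 < Fintype.card V := Fintype.card_pos
    positivity
  rw [badness, mismatch_eq A P hA]
  field_simp
  ring

theorem mismatch_le {T' : ℕ} (A' : LocalAlgorithm Δ T') (ω : Outcome V Δ) :
    A'.mismatch P ω ≤
      A.mismatch P ω + 2 * ∑ v, ∑ i, |A'.mark P ω v i - A.mark P ω v i| := by
  have h := sum_halfEdges_swap P ω fun v i => |A'.mark P ω v i - A.mark P ω v i|
  rw [two_mul]
  nth_rw 2 [← h]
  simp only [mismatch, ← Finset.sum_add_distrib]
  refine Finset.sum_le_sum fun v _ => Finset.sum_le_sum fun i _ => ?_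
  have e : A'.mark P ω v i - A'.coMark P ω v i =
      (A.mark P ω v i - A.coMark P ω v i) + ((A'.mark P ω v i - A.mark P ω v i) -
        (A'.coMark P ω v i - A.coMark P ω v i)) := by ring
  rw [e]
  refine (abs_add_le _ _).trans (add_le_add le_rfl (abs_sub _ _))

end Badness

end LocalAlgorithm

/-! ### Grabbing the preferred directions -/

section Main

variable {V : Type} {G : SimpleGraph V} {Δ k : ℕ} (P : PortNumbering G Δ)

theorem abs_sub_le_one {x y : ℝ} (hx : x = 0 ∨ x = 1) (hy : y = 0 ∨ y = 1) : |x - y| ≤ 1 := by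
  rcases hx with rfl | rfl <;> rcases hy with rfl | rfl <;> simp

theorem abs_sum_abs_le {g : Fin Δ → ℝ} (hg : ∀ i, |g i| ≤ 1) : |(∑ i, |g i|)| ≤ Δ := by
  rw [abs_of_nonneg (Finset.sum_nonneg fun i _ => abs_nonneg _)]
  simpa using Finset.sum_le_sum fun i (_ : i ∈ Finset.univ) => hg i

theorem measurable_pair_left {β : Type*} [MeasurableSpace β] {f : Outcome V Δ → β}
    (hf : Measurable f) (σ : BitStream) :
    Measurable fun η : V → NodeRandomness Δ => f (σ, η) :=
  hf.comp measurable_prodMk_left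

theorem extendView_fst (k : ℕ) (s : Option (Fin Δ)) (q : Fin Δ → Fin Δ × View Δ k)
    (w : View Δ k) (r : List (Fin Δ) → NodeRandomness Δ) : (extendView k s q w r).1 = w := by
  cases k <;> rfl

variable [Fintype V]

instance : IsProbabilityMeasure (outcomeMeasure V Δ) := by
  rw [outcomeMeasure_eq]; infer_instance

theorem integral_outcomeMeasure {f : Outcome V Δ → ℝ} (hf : Measurable f) (C : ℝ)
    (hC : ∀ ω, |f ω| ≤ C) :
    ∫ ω, f ω ∂outcomeMeasure V Δ =
      ∫ σ, ∫ η, f (σ, η) ∂(Measure.pi fun _ : V => nodeMeasure Δ) ∂coinMeasure := by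
  rw [outcomeMeasure_eq]
  exact integral_prod f (integrable_of_bounds hf C hC)

theorem abs_viewAvg_le (p : Fin Δ) {F : View Δ (k + 1) → ℝ} {C : ℝ} (hC : ∀ w, |F w| ≤ C)
    (w : View Δ k) : |viewAvg k p F w| ≤ C := by
  have := norm_integral_le_of_norm_le_const (μ := freshMeasure Δ)
    (f := fun r => F (extendView k none (fun _ => (p, w)) w r)) (ae_of_all _ fun r => hC _)
  simpa [viewAvg] using this

theorem integral_view (hG : ((2 * k + 3 : ℕ) : ℕ∞) < G.egirth) (p : Fin Δ)
    {F : View Δ (k + 1) → ℝ} (hF : Measurable F) {C : ℝ} (hC : ∀ w, |F w| ≤ C) (v : V) :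
    ∫ ω, viewAvg k p F (view P ω k v) ∂outcomeMeasure V Δ =
      ∫ ω, F (view P ω (k + 1) v) ∂outcomeMeasure V Δ := by
  have hm : Measurable fun ω => F (view P ω (k + 1) v) := hF.comp (measurable_view P (k + 1) v)
  have hm' : Measurable fun ω => viewAvg k p F (view P ω k v) :=
    (measurable_viewAvg k p hF).comp (measurable_view P k v)
  rw [integral_outcomeMeasure hm C fun ω => hC _,
    integral_outcomeMeasure hm' C fun ω => abs_viewAvg_le p hC _]
  refine integral_congr_ae (ae_of_all _ fun σ => ?_)
  change ∫ η, viewAvg k p F (view P (σ, η) k v) ∂_ = ∫ η, F (view P (σ, η) (k + 1) v) ∂_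
  rw [← integral_partialAvg (nodeMeasure Δ) (ball G k v) (measurable_pair_left hm σ) C
    fun η => hC _]
  refine integral_congr_ae (ae_of_all _ fun η => ?_)
  exact (integral_view_glue P hG p hF σ η v).symm

namespace LocalAlgorithm

variable (A : LocalAlgorithm Δ (k + 1))

theorem abs_markOfView_le {T : ℕ} (A : LocalAlgorithm Δ T) (w : View Δ T) (i : Fin Δ) :
    |A.markOfView w i| ≤ 1 := by
  unfold markOfView; split <;> simp

/-- The probability, given the radius-`k` view, that port `i` is labelled `M`. -/
def preference (p : Fin Δ) (w : View Δ k) (i : Fin Δ) : ℝ :=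
  viewAvg k p (fun w => A.markOfView w i) w

theorem measurable_preference (p i : Fin Δ) : Measurable fun w => A.preference p w i :=
  measurable_viewAvg k p (A.measurable_markOfView i)

theorem grabProb_ae_eq (hG : ((2 * k + 3 : ℕ) : ℕ∞) < G.egirth) (p : Fin Δ) (v : V)
    (i : Fin Δ) :
    grabProb A P k v i =ᵐ[outcomeMeasure V Δ] fun ω => A.preference p (view P ω k v) i := by
  have hφ : Measurable fun ω => A.preference p (view P ω k v) i :=
    (A.measurable_preference p i).comp (measurable_view P k v)
  have hφb : ∀ w, |A.preference p w i| ≤ 1 :=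
    abs_viewAvg_le p fun w => A.abs_markOfView_le w i
  have hX : Measurable fun ω => A.mark P ω v i := A.measurable_mark P v i
  have hXb : ∀ ω, |A.mark P ω v i| ≤ 1 := fun ω =>
    abs_le_one_of_mem_Icc (zero_or_one_mem_Icc (A.mark_zero_or_one P ω v i))
  refine (ae_eq_condExp_of_forall_setIntegral_eq (measurable_view P k v).comap_le
    (integrable_of_bounds hX 1 hXb) (fun s _ _ => ?_) ?_ ?_).symm
  · exact (integrable_of_bounds hφ 1 fun ω => hφb _).integrableOn
  · rintro s ⟨C, hC, rfl⟩ -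
    have hs := measurable_view P k v hC
    rw [← integral_indicator hs, ← integral_indicator hs]
    set F : View Δ (k + 1) → ℝ := fun w => C.indicator 1 w.1 * A.markOfView w i with hF
    have hFm : Measurable F :=
      ((measurable_one.indicator hC).comp measurable_fst).mul (A.measurable_markOfView i)
    have hFb : ∀ w, |F w| ≤ 1 := fun w => by
      rw [hF, abs_mul]
      refine mul_le_one₀ ?_ (abs_nonneg _) (A.abs_markOfView_le w i)
      by_cases h : w.1 ∈ C <;> simp [h]
    have h1 : ∀ w, viewAvg k p F w = C.indicator 1 w * A.preference p w i := fun w => by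
      rw [preference, viewAvg, viewAvg, ← integral_const_mul]
      simp only [hF, extendView_fst]
    have h2 := integral_view P hG p hFm hFb v
    simp only [h1] at h2
    refine Eq.trans (integral_congr_ae (ae_of_all _ fun ω => ?_))
      (h2.trans (integral_congr_ae (ae_of_all _ fun ω => ?_)))
    · by_cases h : view P ω k v ∈ C
      · simp [h]
      · simp [h]
    · have hv : (view P ω (k + 1) v).1 = view P ω k v := rfl
      change F _ = _
      rw [hF]
      simp only [hv]
      by_cases h : view P ω k v ∈ C
      · rw [Set.indicator_of_mem h, Set.indicator_of_mem (by exact h), ← mark_eq]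
        simp [mark]
      · rw [Set.indicator_of_notMem h, Set.indicator_of_notMem (by exact h), zero_mul]
  · exact ((A.measurable_preference p i).comp
      (comap_measurable fun ω => view P ω k v)).aestronglyMeasurable

open Classical in
/-- The algorithm that gathers the radius-`k` view and grabs the `b` preferred directions. -/
def grabPreferred (b : ℕ) (p : Fin Δ) : LocalAlgorithm Δ k :=
  ofView k (fun w i => decide (IsPreferred b (A.preference p w) i)) <|
    measurable_pi_lambda _ fun i => measurable_to_bool <| by
      have : (fun w : View Δ k => decide (IsPreferred b (A.preference p w) i)) ⁻¹' {true} =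
          {w | IsPreferred b (fun j => A.preference p w j) i} := by
        ext w; simp
      rw [this]
      exact measurableSet_isPreferred (A.measurable_preference p) b i

omit [Fintype V] in
theorem grabPreferred_label (b : ℕ) (p : Fin Δ) (ω : Outcome V Δ) (v : V) (i : Fin Δ) :
    (A.grabPreferred b p).label P ω v i = true ↔
      IsPreferred b (A.preference p (view P ω k v)) i := by
  classical
  rw [grabPreferred, ofView_label, decide_eq_true_iff]

/-- The expected number of changed labels at a node, for fixed shared bits. -/
theorem integral_abs_mark_sub_le (hG : ((2 * k + 3 : ℕ) : ℕ∞) < G.egirth) {b : ℕ}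
    (hb : 1 ≤ b) (hbΔ : b ≤ Δ) (hA : A.NoError P b) (p : Fin Δ) (σ : BitStream) (v : V) :
    ∫ η, ∑ i, |(A.grabPreferred b p).mark P (σ, η) v i - A.mark P (σ, η) v i|
        ∂(Measure.pi fun _ : V => nodeMeasure Δ) ≤
      26 * √b * ∫ η, ∑ i, |A.mark P (σ, η) v i - A.coMark P (σ, η) v i|
        ∂(Measure.pi fun _ : V => nodeMeasure Δ) := by
  classical
  set A' := A.grabPreferred b p
  set π := Measure.pi fun _ : V => nodeMeasure Δ
  set I := ball G k v
  have hX : ∀ i, Measurable fun η : V → NodeRandomness Δ => A.mark P (σ, η) v i := fun i =>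
    measurable_pair_left (A.measurable_mark P v i) σ
  have hX' : ∀ i, Measurable fun η : V → NodeRandomness Δ => A'.mark P (σ, η) v i := fun i =>
    measurable_pair_left (A'.measurable_mark P v i) σ
  have hY : ∀ i, Measurable fun η : V → NodeRandomness Δ => A.coMark P (σ, η) v i := fun i =>
    measurable_pair_left (A.measurable_coMark P v i) σ
  set f₁ : (V → NodeRandomness Δ) → ℝ := fun η => ∑ i, |A'.mark P (σ, η) v i - A.mark P (σ, η) v i|
    with hf₁
  set f₂ : (V → NodeRandomness Δ) → ℝ := fun η => ∑ i, |A.mark P (σ, η) v i - A.coMark P (σ, η) v i|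
  have m₁ : Measurable f₁ :=
    Finset.measurable_fun_sum _ fun i _ => ((hX' i).sub (hX i)).abs
  have m₂ : Measurable f₂ :=
    Finset.measurable_fun_sum _ fun i _ => ((hX i).sub (hY i)).abs
  have b₁ : ∀ η, |f₁ η| ≤ Δ := fun η => abs_sum_abs_le fun i =>
    abs_sub_le_one (A'.mark_zero_or_one P _ _ _) (A.mark_zero_or_one P _ _ _)
  have b₂ : ∀ η, |f₂ η| ≤ Δ := fun η => abs_sum_abs_le fun i =>
    abs_sub_le_one (A.mark_zero_or_one P _ _ _) (A.coMark_zero_or_one P _ _ _)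
  have bavg : ∀ f : (V → NodeRandomness Δ) → ℝ, (∀ η, |f η| ≤ Δ) →
      ∀ η, |partialAvg (nodeMeasure Δ) I f η| ≤ Δ := fun f hf η => by
    have := norm_integral_le_of_norm_le_const (μ := π) (f := fun η' => f (glue I η η'))
      (ae_of_all _ fun r => hf _)
    rw [probReal_univ, mul_one] at this
    exact this
  rw [← integral_partialAvg (nodeMeasure Δ) I m₁ Δ b₁,
    ← integral_partialAvg (nodeMeasure Δ) I m₂ Δ b₂, ← integral_const_mul]
  refine integral_mono
    (integrable_of_bounds (measurable_partialAvg _ I m₁) Δ (bavg _ b₁))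
    ((integrable_of_bounds (measurable_partialAvg _ I m₂) Δ (bavg _ b₂)).const_mul _) fun η => ?_
  -- from here on, the random choices in the ball around `v` are fixed
  change ∫ η', f₁ (glue I η η') ∂π ≤ 26 * √b * ∫ η', f₂ (glue I η η') ∂π
  have hcongr : ∀ η', ∀ w ∈ I, (σ, glue I η η').2 w = ((σ, η) : Outcome V Δ).2 w :=
    fun η' w hw => glue_of_mem hw _ _
  have hview : ∀ η', view P (σ, glue I η η') k v = view P (σ, η) k v := fun η' =>
    view_congr P rfl (hcongr η')
  set X : Fin Δ → (V → NodeRandomness Δ) → ℝ := fun i η' => A.mark P (σ, glue I η η') v i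
  set Y : Fin Δ → (V → NodeRandomness Δ) → ℝ := fun i η' => A.coMark P (σ, glue I η η') v i
  set u : Fin Δ → V := nbr P (σ, η) v
  have hadj : ∀ i, G.Adj v (u i) := fun i => adj_nbr P (σ, η) v i
  have hnbr : ∀ η' i, nbr P (σ, glue I η η') v i = u i := fun η' i =>
    nbr_congr P (hcongr η' v (self_mem_ball k v)) i
  have hXm : ∀ i, Measurable (X i) := fun i => (hX i).comp (measurable_glue_right I η)
  have hYm : ∀ i, Measurable (Y i) := fun i => (hY i).comp (measurable_glue_right I η)
  have hmarkdep : ∀ (w : V) (i : Fin Δ), DependsOn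
      (fun η : V → NodeRandomness Δ => A.mark P (σ, η) w i) (ball G (k + 1) w) :=
    fun w i x y h => by
      simp only [mark_eq]
      rw [view_congr P (ω := (σ, x)) (ω' := (σ, y)) rfl h]
  have hXdep : ∀ i, DependsOn (X i) (ball G (k + 1) v \ I) := fun i =>
    dependsOn_glue (hmarkdep v i) I η
  have hYdep : ∀ i, DependsOn (Y i) (ball G (k + 1) (u i) \ I) := fun i => by
    have h1 : Y i = fun η' => A.markTo P (σ, glue I η η') (hadj i) := funext fun η' =>
      A.coMark_eq_markTo P (hadj i) (hnbr η' i)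
    rw [h1]
    refine dependsOn_glue (F := fun η => A.markTo P (σ, η) (hadj i)) (fun x y h => ?_) I η
    simp only [markTo, h (u i) (self_mem_ball _ _)]
    exact hmarkdep (u i) _ h
  have hpref : ∀ i, A.preference p (view P (σ, η) k v) i = ∫ η', X i η' ∂π := fun i => by
    rw [preference, ← integral_view_glue P hG p (A.measurable_markOfView i)]
    simp only [X, mark_eq]
    rfl
  set B := preferredPorts b (A.preference p (view P (σ, η) k v)) with hB
  have hmark' : ∀ η' i, A'.mark P (σ, glue I η η') v i = if i ∈ B then 1 else 0 := fun η' i => by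
    simp only [mark, A', grabPreferred_label, hview, hB, mem_preferredPorts]
  have h01 : ∀ i η', |(if i ∈ B then (1 : ℝ) else 0) - X i η'| ≤ 1 := fun i η' =>
    abs_sub_le_one (by split_ifs <;> simp) (A.mark_zero_or_one P _ _ _)
  have key := sum_integral_abs_sub_preferred_le (nodeMeasure Δ) hb hXm hYm
    (fun i η' => A.mark_zero_or_one P _ _ _) (fun i η' => A.coMark_zero_or_one P _ _ _)
    hXdep hYdep (K := fun i => ball G k (u i) \ I)
    (fun i w hw => ⟨(ball_inter_ball_subset hG (hadj i) ⟨hw.1.1, hw.2.1⟩).resolve_left hw.1.2,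
      hw.1.2⟩)
    (fun i j hij => ball_diff_disjoint hG (hadj i) (hadj j)
      fun h => hij (nbr_injective P (σ, η) v h))
    (fun η' => A.sum_mark P hA _ v) (card_preferredPorts hbΔ (A.preference p (view P (σ, η) k v)))
    (fun i hi j hj => by
      have := le_of_mem_preferredPorts hi hj
      rwa [hpref, hpref] at this)
  have e₁ : ∫ η', f₁ (glue I η η') ∂π =
      ∑ i, ∫ η', |(if i ∈ B then 1 else 0) - X i η'| ∂π := by
    simp only [hf₁, hmark']
    refine integral_finsetSum _ fun i _ => ?_
    exact integrable_of_bounds ((hXm i).const_sub _).abs 1 fun η' => by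
      rw [abs_abs]; exact h01 i η'
  have e₂ : ∫ η', f₂ (glue I η η') ∂π = ∑ i, ∫ η', |X i η' - Y i η'| ∂π := by
    refine integral_finsetSum _ fun i _ => ?_
    exact integrable_of_bounds ((hXm i).sub (hYm i)).abs 1 fun η' => by
      rw [abs_abs]
      exact abs_sub_le_one (A.mark_zero_or_one P _ _ _) (A.coMark_zero_or_one P _ _ _)
  rw [e₁, e₂]
  exact key

omit [Fintype V] in
theorem grabPreferred_noError {b : ℕ} (hbΔ : b ≤ Δ) (p : Fin Δ) :
    (A.grabPreferred b p).NoError P b := fun ω v => by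
  refine Eq.trans (congrArg Finset.card ?_)
    (card_preferredPorts hbΔ (A.preference p (view P ω k v)))
  ext i
  rw [mem_preferredPorts, Finset.mem_filter, grabPreferred_label]
  simp

theorem expectedBadness_grabPreferred_le (hG : ((2 * k + 3 : ℕ) : ℕ∞) < G.egirth) [Nonempty V]
    {b : ℕ} (hb : 1 ≤ b) (hbΔ : b ≤ Δ) (hA : A.NoError P b) (p : Fin Δ) :
    (A.grabPreferred b p).expectedBadness P b ≤ 53 * √b * A.expectedBadness P b := by
  have hA' := A.grabPreferred_noError P hbΔ p
  set A' := A.grabPreferred b p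
  set μ := outcomeMeasure V Δ
  set R : V → Outcome V Δ → ℝ := fun v ω => ∑ i, |A'.mark P ω v i - A.mark P ω v i|
  set D : V → Outcome V Δ → ℝ := fun v ω => ∑ i, |A.mark P ω v i - A.coMark P ω v i| with hD
  have hRm : ∀ v, Measurable (R v) := fun v => Finset.measurable_fun_sum _ fun i _ =>
    ((A'.measurable_mark P v i).sub (A.measurable_mark P v i)).abs
  have hDm : ∀ v, Measurable (D v) := fun v => Finset.measurable_fun_sum _ fun i _ =>
    ((A.measurable_mark P v i).sub (A.measurable_coMark P v i)).abs
  have hRb : ∀ v ω, |R v ω| ≤ Δ := fun v ω => abs_sum_abs_le fun i =>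
    abs_sub_le_one (A'.mark_zero_or_one P _ _ _) (A.mark_zero_or_one P _ _ _)
  have hDb : ∀ v ω, |D v ω| ≤ Δ := fun v ω => abs_sum_abs_le fun i =>
    abs_sub_le_one (A.mark_zero_or_one P _ _ _) (A.coMark_zero_or_one P _ _ _)
  have hD'b : ∀ v ω, |(∑ i, |A'.mark P ω v i - A'.coMark P ω v i|)| ≤ Δ := fun v ω => abs_sum_abs_le fun i =>
    abs_sub_le_one (A'.mark_zero_or_one P _ _ _) (A'.coMark_zero_or_one P _ _ _)
  have hRi : ∀ v, Integrable (R v) μ := fun v => integrable_of_bounds (hRm v) Δ (hRb v)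
  have hDi : ∀ v, Integrable (D v) μ := fun v => integrable_of_bounds (hDm v) Δ (hDb v)
  have hMi : Integrable (fun ω => A.mismatch P ω) μ := integrable_finsetSum _ fun v _ => hDi v
  have hMi' : Integrable (fun ω => A'.mismatch P ω) μ := integrable_finsetSum _ fun v _ =>
    integrable_of_bounds (Finset.measurable_fun_sum _ fun i _ =>
      ((A'.measurable_mark P v i).sub (A'.measurable_coMark P v i)).abs) Δ (hD'b v)
  have hnode : ∀ v, ∫ ω, R v ω ∂μ ≤ 26 * √b * ∫ ω, D v ω ∂μ := fun v => by
    rw [integral_outcomeMeasure (hRm v) Δ (hRb v), integral_outcomeMeasure (hDm v) Δ (hDb v),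
      ← integral_const_mul]
    have hi : ∀ f : Outcome V Δ → ℝ, Integrable f μ → Integrable
        (fun σ => ∫ η, f (σ, η) ∂(Measure.pi fun _ : V => nodeMeasure Δ)) coinMeasure :=
      fun f hf => Integrable.integral_prod_left hf
    exact integral_mono (hi _ (hRi v)) ((hi _ (hDi v)).const_mul _) fun σ =>
      A.integral_abs_mark_sub_le P hG hb hbΔ hA p σ v
  have hRsum : ∫ ω, ∑ v, R v ω ∂μ ≤ 26 * √b * ∫ ω, A.mismatch P ω ∂μ := by
    rw [integral_finsetSum _ fun v _ => hRi v]
    simp only [mismatch]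
    rw [integral_finsetSum _ fun v _ => hDi v, Finset.mul_sum]
    exact Finset.sum_le_sum fun v _ => hnode v
  have hRint : Integrable (fun ω => ∑ v, R v ω) μ := integrable_finsetSum _ fun v _ => hRi v
  have hmis : ∫ ω, A'.mismatch P ω ∂μ ≤
      ∫ ω, A.mismatch P ω ∂μ + 2 * ∫ ω, ∑ v, R v ω ∂μ := by
    rw [← integral_const_mul, ← integral_add hMi (hRint.const_mul 2)]
    exact integral_mono hMi' (hMi.add (hRint.const_mul 2)) fun ω => A.mismatch_le P A' ω
  have hM0 : 0 ≤ ∫ ω, A.mismatch P ω ∂μ := integral_nonneg fun ω =>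
    Finset.sum_nonneg fun v _ => Finset.sum_nonneg fun i _ => abs_nonneg _
  have hb1 : 1 ≤ √(b : ℝ) := Real.one_le_sqrt.2 (by exact_mod_cast hb)
  simp only [expectedBadness, badness_eq A P hb hA, badness_eq A' P hb hA', integral_const_mul]
  have hfinal : ∫ ω, A'.mismatch P ω ∂μ ≤ 53 * √b * ∫ ω, A.mismatch P ω ∂μ := by nlinarith
  exact (mul_le_mul_of_nonneg_left hfinal (by positivity)).trans_eq (by ring)

end LocalAlgorithm

end Main

end Grabbing

end

theorem mainTheorem3 :
    ∃ c : ℝ, 1 < c ∧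
      ∀ (ε : ℝ) (n Δ b T : ℕ), 0 < ε → 2 ≤ Δ → 1 ≤ b → 1 ≤ T →
        (T : ℝ) ≤ ε / 4 * Real.logb Δ n →
        ∀ A : Grabbing.LocalAlgorithm Δ T, ∃ A' : Grabbing.LocalAlgorithm Δ (T - 1),
          ∀ (V : Type) [Fintype V] (G : SimpleGraph V) [DecidableRel G.Adj]
            (P : Grabbing.PortNumbering G Δ) (p : ℝ),
            Fintype.card V = n →
            G.IsRegularOfDegree Δ →
            ENNReal.ofReal (ε * Real.logb Δ n) ≤ (G.egirth : ℝ≥0∞) →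
            A.NoError P b →
            A.expectedBadness P b ≤ p →
            A'.NoError P b ∧
            A'.expectedBadness P b ≤ c * Real.sqrt b * p ∧
            ∀ v : V, ∀ᵐ ω ∂(Grabbing.outcomeMeasure V Δ), ∀ i : Fin Δ,
              A'.label P ω v i = true ↔
                Grabbing.IsPreferred b (fun j => Grabbing.grabProb A P (T - 1) v j ω) i := by
  refine ⟨53, by norm_num, fun ε n Δ b T _ hΔ hb hT hTn A => ?_⟩
  obtain ⟨k, rfl⟩ : ∃ k, T = k + 1 := ⟨T - 1, by omega⟩
  have p₀ : Fin Δ := ⟨0, by omega⟩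
  refine ⟨A.grabPreferred b p₀, fun V _ G _ P p hn _ hgirth hA hp => ?_⟩
  have hTn' : ((4 * (k + 1) : ℕ) : ℝ) ≤ ε * Real.logb Δ n := by
    push_cast at hTn ⊢
    linarith
  have hG : ((2 * k + 3 : ℕ) : ℕ∞) < G.egirth := by
    have h1 : ((4 * (k + 1) : ℕ) : ℝ≥0∞) ≤ (G.egirth : ℝ≥0∞) := by
      refine le_trans ?_ hgirth
      rw [← ENNReal.ofReal_natCast]
      exact ENNReal.ofReal_le_ofReal hTn'
    have h2 : ((4 * (k + 1) : ℕ) : ℕ∞) ≤ G.egirth := by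
      rw [← ENat.toENNReal_le]
      simpa using h1
    exact lt_of_lt_of_le (by exact_mod_cast by omega) h2
  have : Nonempty V := by
    rw [← Fintype.card_pos_iff, hn]
    refine Nat.pos_of_ne_zero fun h0 => ?_
    rw [h0] at hTn'
    simp only [Nat.cast_zero, Real.logb_zero, mul_zero] at hTn'
    have : (0 : ℝ) < ((4 * (k + 1) : ℕ) : ℝ) := by positivity
    linarith
  have hbΔ : b ≤ Δ := by
    obtain ⟨v⟩ := this
    rw [← hA (fun _ => false, fun _ => (1, fun _ => false)) v]
    exact (Finset.card_filter_le _ _).trans (by simp)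
  refine ⟨A.grabPreferred_noError P hbΔ p₀, ?_, fun v => ?_⟩
  · refine (A.expectedBadness_grabPreferred_le P hG hb hbΔ hA p₀).trans ?_
    gcongr
  · filter_upwards [ae_all_iff.2 fun j => A.grabProb_ae_eq P hG p₀ v j] with ω hω i
    have h : (fun j => Grabbing.grabProb A P (k + 1 - 1) v j ω) =
        A.preference p₀ (Grabbing.view P ω k v) := funext hω
    rw [h]
    exact A.grabPreferred_label P b p₀ ω v i
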